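/- Notation. Let $q\in\mathbb N$, let $\Theta\subset\mathbb R^q$, let $k\ge 1$, and let $\Phi$ be a family of real-valued functions on $\Theta$, each regarded as defined on a larger set containing $\Theta$ in its interior, so that derivatives at points of $\Theta$ make sense. Write $\mathcal E_j(\Theta)$ (resp. $\mathcal G_j(\Theta)$) for the set of discrete probability distributions on $\Theta$ with exactly (resp. at most) $j$ distinct atoms. For $G=\sum_i p_i\delta_{\theta_i}$ put $G\phi=\int\phi\,dG=\sum_i p_i\phi(\theta_i)$. For $r\ge 1$ and $G=\sum_i p_i\delta_{\theta_i}$, $H=\sum_j p_j'\delta_{\theta_j'}$, let $W_r(G,H)=\left(\min_{c}\sum_{i,j}c_{ij}\|\theta_i-\theta_j'\|_2^r\right)^{1/r}$, the minimum being over all nonnegative matrices $c$ with $\sum_j c_{ij}=p_i$ and $\sum_i c_{ij}=p'_j$. For integers $m\ge 0$ and $1\le k_0\le k$, the family $\Phi$ is an $(m,k_0,k)$ linear independent domain if (1) each $\phi\in\Phi$ is $m$ times continuously differentiable on a neighbourhood of $\Theta$; and (2) for every integer $\ell$ with $k_0\le\ell\le 2k-k_0$, all integers $m_1,\dots,m_\ell$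 with $1\le m_i\le m+1$ and $2k_0\le\sum_{i=1}^\ell m_i\le 2k$, all distinct $\theta_1,\dots,\theta_\ell\in\Theta$, and all real numbers $a_{i\alpha}$ ($1\le i\le\ell$, $\alpha\in\mathbb N^q$, $|\alpha|\le m_i-1$), one has $$\sum_{i=1}^\ell\ \sum_{|\alpha|\le m_i-1}a_{i\alpha}D^\alpha\phi(\theta_i)=0\ \ \text{for all }\phi\in\Phi\quad\text{and}\quad \sum_{i=1}^\ell a_{i\mathbf 0}=0$$ if and only if all the $a_{i\alpha}$ are $0$. For $G_0\in\mathcal G_k(\Theta)$ with exactly $k_0$ atoms, put $d_1=d_1(G_0)=k-k_0+1$. The local inverse bound holds at $G_0$ if $$\liminf_{\substack{G,H\to G_0\text{ in }W_1\\ G\ne H\in\mathcal G_k(\Theta)}}\ \frac{\sup_{\phi\in\Phi}|G\phi-H\phi|}{W_{2d_1-1}^{2d_1-1}(G,H)}>0,$$ where the supremum may be $+\infty$ and the $\liminf$ is $+\infty$ if there are no such pairs $G\ne H$ near $G_0$. Theorem. Let $\Theta\subset\mathbb R^q$ be compact. (a) Let $1\le k_0\le k$ and $d_1=k-k_0+1$.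 If $\Phi$ is a $(2d_1-1,k_0,k)$ linear independent domain, then the local inverse bound holds at every $G_0\in\mathcal E_{k_0}(\Theta)$. (b) If $\Phi$ is a $(2k-1,1,k)$ linear independent domain, then the local inverse bound holds at every $G_0\in\mathcal G_k(\Theta)$, with $d_1=d_1(G_0)$ determined by the number of atoms of $G_0$. -/

import Mathlib

open Convexity Filter Topology
open scoped ENNReal

noncomputable section

namespace MixingMeasure

/-- Finitely supported probability distributions on `ℝ^q`, given by their weights
(`G.weights θ` is the mass of the point `θ`). -/
abbrev DiscreteProb (q : ℕ) : Type := StdSimplex ℝ (EuclideanSpace ℝ (Fin q))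

variable {q : ℕ}

/-- The set of atoms of `G`. -/
def atoms (G : DiscreteProb q) : Finset (EuclideanSpace ℝ (Fin q)) := G.weights.support

/-- `𝓔_k(Θ)`: the discrete probability distributions with exactly `k` atoms, all lying in `Θ`. -/
def exactly (k : ℕ) (Θ : Set (EuclideanSpace ℝ (Fin q))) : Set (DiscreteProb q) :=
  {G | (atoms G : Set (EuclideanSpace ℝ (Fin q))) ⊆ Θ ∧ (atoms G).card = k}

/-- `𝓖_k(Θ)`: the discrete probability distributions with at most `k` atoms, all lying in `Θ`. -/
def atMost (k : ℕ) (Θ : Set (EuclideanSpace ℝ (Fin q))) : Set (DiscreteProb q) :=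
  {G | (atoms G : Set (EuclideanSpace ℝ (Fin q))) ⊆ Θ ∧ (atoms G).card ≤ k}

/-- `G φ = ∫ φ dG = ∑ᵢ pᵢ φ(θᵢ)`. -/
def integral (G : DiscreteProb q) (φ : EuclideanSpace ℝ (Fin q) → ℝ) : ℝ :=
  ∑ θ ∈ atoms G, G.weights θ * φ θ

/-- `c` is a joint probability distribution on `atoms G × atoms H` with marginals `G` and `H`
(the total mass is `1` because it is that of `G`). -/
structure IsCoupling (G H : DiscreteProb q)
    (c : EuclideanSpace ℝ (Fin q) → EuclideanSpace ℝ (Fin q) → ℝ) : Prop where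
  nonneg : ∀ θ ∈ atoms G, ∀ η ∈ atoms H, 0 ≤ c θ η
  marginal_left : ∀ θ ∈ atoms G, ∑ η ∈ atoms H, c θ η = G.weights θ
  marginal_right : ∀ η ∈ atoms H, ∑ θ ∈ atoms G, c θ η = H.weights η

/-- The transport cost of order `r` of `c`, for the Euclidean distance. -/
def transportCost (r : ℕ) (G H : DiscreteProb q)
    (c : EuclideanSpace ℝ (Fin q) → EuclideanSpace ℝ (Fin q) → ℝ) : ℝ :=
  ∑ θ ∈ atoms G, ∑ η ∈ atoms H, c θ η * ‖θ - η‖ ^ r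

/-- The Wasserstein distance `W_r(G, H)` for the Euclidean distance (for `r ≥ 1`). The set of
costs is nonempty (independent coupling) and bounded below by `0`. -/
def wasserstein (r : ℕ) (G H : DiscreteProb q) : ℝ :=
  (sInf {x : ℝ | ∃ c, IsCoupling G H c ∧ x = transportCost r G H c}) ^ ((1 : ℝ) / (r : ℝ))

/-- `sup_{φ ∈ Φ} |G φ - H φ|`, as an element of `[0, ∞]`. -/
def deviation (Φ : Set (EuclideanSpace ℝ (Fin q) → ℝ)) (G H : DiscreteProb q) : ℝ≥0∞ :=
  ⨆ φ ∈ Φ, ENNReal.ofReal |integral G φ - integral H φ|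

/-- The overfit index `d₁ = k - k₀ + 1`, where `k₀` is the number of atoms of `G₀`. -/
def overfitIndex (k : ℕ) (G₀ : DiscreteProb q) : ℕ := k - (atoms G₀).card + 1

/-- The filter of pairs `(G, H)` with `G ≠ H` in `𝓖_k(Θ)` and `G, H → G₀` in `W₁`. -/
def pairsTo (Θ : Set (EuclideanSpace ℝ (Fin q))) (k : ℕ) (G₀ : DiscreteProb q) :
    Filter (DiscreteProb q × DiscreteProb q) :=
  comap (fun p => (wasserstein 1 p.1 G₀, wasserstein 1 p.2 G₀)) (𝓝 ((0 : ℝ), (0 : ℝ))) ⊓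
    𝓟 {p | p.1 ∈ atMost k Θ ∧ p.2 ∈ atMost k Θ ∧ p.1 ≠ p.2}

/-- The local inverse bound at `G₀`:
`liminf sup_{φ ∈ Φ} |G φ - H φ| / W_{2d₁-1}^{2d₁-1}(G, H) > 0` as `G, H → G₀` in `W₁` with
`G ≠ H` in `𝓖_k(Θ)`. -/
def LocalInverseBound (Φ : Set (EuclideanSpace ℝ (Fin q) → ℝ))
    (Θ : Set (EuclideanSpace ℝ (Fin q))) (k : ℕ) (G₀ : DiscreteProb q) : Prop :=
  0 < liminf
    (fun p : DiscreteProb q × DiscreteProb q => deviation Φ p.1 p.2 /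
      ENNReal.ofReal (wasserstein (2 * overfitIndex k G₀ - 1) p.1 p.2 ^
        (2 * overfitIndex k G₀ - 1)))
    (pairsTo Θ k G₀)

/-- The list of coordinates in which the coordinate `i` is repeated `α i` times. -/
def directions (α : Fin q → ℕ) : List (Fin q) :=
  (List.finRange q).flatMap fun i => List.replicate (α i) i

/-- The partial derivative `D^α φ(θ)` for a multi-index `α`: the derivative of order `α i` in the
`i`-th coordinate for every `i`. -/
def partialDeriv (α : Fin q → ℕ) (φ : EuclideanSpace ℝ (Fin q) → ℝ)
    (θ : EuclideanSpace ℝ (Fin q)) : ℝ :=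
  iteratedFDeriv ℝ (directions α).length φ θ
    fun j => EuclideanSpace.single ((directions α).get j) (1 : ℝ)

/-- The multi-indices `α` with `|α| < n`. -/
def multiIndices (q n : ℕ) : Finset (Fin q → ℕ) :=
  (Fintype.piFinset fun _ => Finset.range n).filter fun α => ∑ i, α i < n

/-- `(m, k₀, k)` linear independent domains on `Θ`. The members of `Φ` are functions on `ℝ^q`, of
which only the values near `Θ` matter. -/
structure IsLinearIndependentDomain (Φ : Set (EuclideanSpace ℝ (Fin q) → ℝ))
    (Θ : Set (EuclideanSpace ℝ (Fin q))) (m k₀ k : ℕ) : Prop where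
  contDiff : ∀ φ ∈ Φ, ∃ U : Set (EuclideanSpace ℝ (Fin q)),
    IsOpen U ∧ Θ ⊆ U ∧ ContDiffOn ℝ (m : ℕ∞) φ U
  linearIndependent : ∀ ℓ : ℕ, k₀ ≤ ℓ → ℓ ≤ 2 * k - k₀ →
    ∀ μ : Fin ℓ → ℕ, (∀ i, 1 ≤ μ i ∧ μ i ≤ m + 1) →
      2 * k₀ ≤ ∑ i, μ i → ∑ i, μ i ≤ 2 * k →
    ∀ θ : Fin ℓ → EuclideanSpace ℝ (Fin q), Function.Injective θ → (∀ i, θ i ∈ Θ) →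
    ∀ a : Fin ℓ → (Fin q → ℕ) → ℝ,
      (((∀ φ ∈ Φ, ∑ i, ∑ α ∈ multiIndices q (μ i), a i α * partialDeriv α φ (θ i) = 0) ∧
          ∑ i, a i 0 = 0) ↔
        ∀ i, ∀ α ∈ multiIndices q (μ i), a i α = 0)

end MixingMeasure

end

noncomputable section

namespace MixingMeasure

variable {q : ℕ}

/-! Suppose the bound fails at G₀. Along some ultrafilter of pairs (G, H) tending to G₀, the
quotient tends to 0. Since Θ is compact, the atoms of G and H converge along it, so the labels of G
- H fall into clusters, one for each limit point. Let S be the total size of the moments of the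
clusters about their limit points, where a cluster of m labels contributes its moments of order less
than m. Put r = 2d₁ - 1. Two facts then give a contradiction.

Limit functional. A signed measure on n + 1 points is controlled by its moments of order at most n
(`abs_sum_le_of_moments`). Applied to Taylor remainders, this shows that (G - H)/S converges on each
φ in Φ to a combination of derivatives D^α φ(θ) with |α| < m_θ (`tendsto_sum_div_momentSize`). Its
coefficients are not all 0, because S is the normalization, and those of order 0 add up to 0,
because G - H has total mass 0.

Transport. W_r^r(G, H) ≤ C S (`exists_wasserstein_pow_le_momentSize`). Testing against a cutoff at
scale ρ, any part of G - H at distance ρ from the rest has mass O(S ρ⁻ʳ) (`exists_gap_bound`). A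
greedy transport of the positive part to the negative part then costs O(S) (`exists_transport`).

Hence Gφ - Hφ = o(W_r^r) = o(S), so the limit functional vanishes on Φ, against linear independence.
The numbers fit because every atom of G₀ attracts at least one atom of G and one of H: a cluster has
at most 2k - 2(k₀ - 1) = 2d₁ = r + 1 labels, and there are at most 2k - k₀ clusters. -/

/-- The `a`-th coordinate derivative. -/
def coordDeriv (a : Fin q) (f : EuclideanSpace ℝ (Fin q) → ℝ) (x : EuclideanSpace ℝ (Fin q)) : ℝ :=
  fderiv ℝ f x (EuclideanSpace.single a 1)

/-- All iterated coordinate derivatives of `f` of order at most `n` are bounded by `ε` on `U`. -/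
def DerivBound (U : Set (EuclideanSpace ℝ (Fin q))) :
    ℕ → ℝ → (EuclideanSpace ℝ (Fin q) → ℝ) → Prop
  | 0, ε, f => ∀ x ∈ U, |f x| ≤ ε
  | n + 1, ε, f => (∀ x ∈ U, |f x| ≤ ε) ∧ (∀ x ∈ U, DifferentiableAt ℝ f x) ∧
      ∀ a, DerivBound U n ε (coordDeriv a f)

/-- The monomial `y ^ α`. -/
def monomial (α : Fin q → ℕ) (y : EuclideanSpace ℝ (Fin q)) : ℝ := ∏ a, y a ^ α a

@[simp] lemma monomial_zero (y : EuclideanSpace ℝ (Fin q)) : monomial 0 y = 1 := by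
  simp [monomial]

lemma monomial_add_single (α : Fin q → ℕ) (a : Fin q) (y : EuclideanSpace ℝ (Fin q)) :
    monomial (α + Pi.single a 1) y = y a * monomial α y := by
  have : ∀ b, y b ^ (α + Pi.single a 1 : Fin q → ℕ) b = y b ^ α b * (if b = a then y b else 1) := by
    intro b
    by_cases h : b = a
    · subst h; simp [pow_succ]
    · simp [h]
  simp only [monomial, this, Finset.prod_mul_distrib]
  rw [Finset.prod_ite_eq' Finset.univ a (fun b => y b), if_pos (Finset.mem_univ a), mul_comm]

lemma mem_multiIndices {n : ℕ} {α : Fin q → ℕ} : α ∈ multiIndices q n ↔ ∑ i, α i < n := by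
  simp only [multiIndices, Finset.mem_filter, Fintype.mem_piFinset, Finset.mem_range,
    and_iff_right_iff_imp]
  intro h i
  exact (Finset.single_le_sum (fun j _ => Nat.zero_le (α j)) (Finset.mem_univ i)).trans_lt h

lemma sum_add_single (α : Fin q → ℕ) (a : Fin q) :
    ∑ i, (α + Pi.single a 1 : Fin q → ℕ) i = ∑ i, α i + 1 := by
  simp [Finset.sum_add_distrib]

lemma map_eq_sum_coord (L : EuclideanSpace ℝ (Fin q) →L[ℝ] ℝ) (v : EuclideanSpace ℝ (Fin q)) :
    L v = ∑ a, v a * L (EuclideanSpace.single a 1) := by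
  conv_lhs => rw [← (EuclideanSpace.basisFun (Fin q) ℝ).sum_repr v]
  simp

/-! ### Calculus of functions with bounded derivatives -/

section DerivBound

variable {U V : Set (EuclideanSpace ℝ (Fin q))} {n : ℕ} {ε δ : ℝ}
  {f g : EuclideanSpace ℝ (Fin q) → ℝ}

lemma DerivBound.abs_le (h : DerivBound U n ε f) : ∀ x ∈ U, |f x| ≤ ε := by
  cases n with
  | zero => exact h
  | succ n => exact h.1

lemma DerivBound.mono_bound (h : DerivBound U n ε f) (hε : ε ≤ δ) : DerivBound U n δ f := by
  induction n generalizing f with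
  | zero => exact fun x hx => (h x hx).trans hε
  | succ n ih => exact ⟨fun x hx => (h.1 x hx).trans hε, h.2.1, fun a => ih (h.2.2 a)⟩

lemma DerivBound.of_succ (h : DerivBound U (n + 1) ε f) : DerivBound U n ε f := by
  induction n generalizing f with
  | zero => exact h.1
  | succ n ih => exact ⟨h.1, h.2.1, fun a => ih (h.2.2 a)⟩

lemma DerivBound.congr (hU : IsOpen U) (h : DerivBound U n ε f) (hfg : ∀ x ∈ U, f x = g x) :
    DerivBound U n ε g := by
  have hev : ∀ x ∈ U, g =ᶠ[𝓝 x] f := fun x hx =>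
    (hU.eventually_mem hx).mono fun y hy => (hfg y hy).symm
  induction n generalizing f g with
  | zero => exact fun x hx => hfg x hx ▸ h x hx
  | succ n ih =>
    refine ⟨fun x hx => hfg x hx ▸ h.1 x hx,
      fun x hx => (h.2.1 x hx).congr_of_eventuallyEq (hev x hx), fun a => ?_⟩
    have key : ∀ x ∈ U, coordDeriv a f x = coordDeriv a g x := fun x hx => by
      rw [coordDeriv, coordDeriv, (hev x hx).fderiv_eq]
    exact ih (h.2.2 a) key fun x hx => (hU.eventually_mem hx).mono fun y hy => (key y hy).symm

lemma DerivBound.const_mul (hU : IsOpen U) (h : DerivBound U n ε f) (c : ℝ) :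
    DerivBound U n (|c| * ε) (fun x => c * f x) := by
  induction n generalizing f with
  | zero =>
    intro x hx
    rw [abs_mul]
    exact mul_le_mul_of_nonneg_left (h x hx) (abs_nonneg c)
  | succ n ih =>
    refine ⟨fun x hx => ?_, fun x hx => (h.2.1 x hx).const_mul c, fun a => ?_⟩
    · rw [abs_mul]
      exact mul_le_mul_of_nonneg_left (h.1 x hx) (abs_nonneg c)
    · refine (ih (h.2.2 a)).congr hU fun x hx => ?_
      rw [coordDeriv, coordDeriv, fderiv_const_mul (h.2.1 x hx)]
      simp

lemma DerivBound.add (hU : IsOpen U) (hf : DerivBound U n ε f) (hg : DerivBound U n δ g) :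
    DerivBound U n (ε + δ) (fun x => f x + g x) := by
  induction n generalizing f g with
  | zero => exact fun x hx => (abs_add_le _ _).trans (add_le_add (hf x hx) (hg x hx))
  | succ n ih =>
    refine ⟨fun x hx => (abs_add_le _ _).trans (add_le_add (hf.1 x hx) (hg.1 x hx)),
      fun x hx => (hf.2.1 x hx).add (hg.2.1 x hx), fun a => ?_⟩
    refine (ih (hf.2.2 a) (hg.2.2 a)).congr hU fun x hx => ?_
    rw [coordDeriv, coordDeriv, coordDeriv, fderiv_fun_add (hf.2.1 x hx) (hg.2.1 x hx)]
    simp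

/-- By the product rule each differentiation doubles the number of terms, whence the factor 2ⁿ. -/
lemma DerivBound.mul (hU : IsOpen U) (hε : 0 ≤ ε) (hδ : 0 ≤ δ)
    (hf : DerivBound U n ε f) (hg : DerivBound U n δ g) :
    DerivBound U n (2 ^ n * (ε * δ)) (fun x => f x * g x) := by
  induction n generalizing f g with
  | zero =>
    intro x hx
    rw [abs_mul, pow_zero, one_mul]
    exact mul_le_mul (hf x hx) (hg x hx) (abs_nonneg _) hε
  | succ n ih =>
    refine ⟨fun x hx => ?_, fun x hx => (hf.2.1 x hx).mul (hg.2.1 x hx), fun a => ?_⟩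
    · rw [abs_mul]
      have h1 := mul_le_mul (hf.1 x hx) (hg.1 x hx) (abs_nonneg _) hε
      have h2 : (1 : ℝ) ≤ 2 ^ (n + 1) := one_le_pow₀ (by norm_num)
      nlinarith [mul_nonneg hε hδ]
    · have h := (ih hf.of_succ (hg.2.2 a)).add hU (ih (hf.2.2 a) hg.of_succ)
      refine (h.congr hU fun x hx => ?_).mono_bound (le_of_eq (by ring))
      rw [coordDeriv, coordDeriv, coordDeriv, fderiv_fun_mul (hf.2.1 x hx) (hg.2.1 x hx)]
      simp only [_root_.add_apply, _root_.smul_apply, smul_eq_mul]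
      ring

lemma derivBound_const (U : Set (EuclideanSpace ℝ (Fin q))) (n : ℕ) (c : ℝ) :
    DerivBound U n |c| (fun _ => c) := by
  induction n generalizing c with
  | zero => exact fun x _ => le_rfl
  | succ n ih =>
    refine ⟨fun x _ => le_rfl, fun x _ => differentiableAt_const c, fun a => ?_⟩
    have : coordDeriv a (fun _ : EuclideanSpace ℝ (Fin q) => c) = fun _ => 0 := by
      ext x; simp [coordDeriv]
    rw [this]
    exact (ih 0).mono_bound (by simp)

lemma DerivBound.comp_affine (hV : IsOpen V) (h : DerivBound U n ε f) (hε : 0 ≤ ε) {s S : ℝ}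
    (v : EuclideanSpace ℝ (Fin q)) (hs : |s| ≤ S) (hS : 1 ≤ S)
    (hmap : ∀ x ∈ V, s • x + v ∈ U) :
    DerivBound V n (ε * S ^ n) (fun x => f (s • x + v)) := by
  induction n generalizing f with
  | zero => exact fun x hx => (h _ (hmap x hx)).trans (by simp)
  | succ n ih =>
    have hd : ∀ x, HasFDerivAt (fun x : EuclideanSpace ℝ (Fin q) => s • x + v)
        (s • ContinuousLinearMap.id ℝ (EuclideanSpace ℝ (Fin q))) x := fun x =>
      ((hasFDerivAt_id x).const_smul s).add_const v
    have hS' : (1 : ℝ) ≤ S ^ (n + 1) := one_le_pow₀ hS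
    refine ⟨fun x hx => (h.1 _ (hmap x hx)).trans (by nlinarith),
      fun x hx => (h.2.1 _ (hmap x hx)).comp x (hd x).differentiableAt, fun a => ?_⟩
    have hSn : 0 ≤ ε * S ^ n := mul_nonneg hε (pow_nonneg (by linarith) n)
    refine ((((ih (h.2.2 a)).const_mul hV s)).congr hV fun x hx => ?_).mono_bound ?_
    · have := ((h.2.1 _ (hmap x hx)).hasFDerivAt.comp x (hd x)).fderiv
      rw [coordDeriv, coordDeriv]
      erw [this]
      simp
    · rw [pow_succ]
      nlinarith

end DerivBound

/-! ### Few-point signed measures and their moments -/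

/-- A discrete signed measure with at most `n + 1` points is controlled, as a functional on
functions with bounded derivatives of order at most `n`, by its moments of order at most `n`. -/
theorem abs_sum_le_of_moments {ι : Type*} {U : Set (EuclideanSpace ℝ (Fin q))} (hU : IsOpen U)
    (hUc : Convex ℝ U) {c : EuclideanSpace ℝ (Fin q)} (hU1 : U ⊆ Metric.ball c 1) {n : ℕ}
    {ε N : ℝ} {f : EuclideanSpace ℝ (Fin q) → ℝ} (hf : DerivBound U n ε f) (hε : 0 ≤ ε)
    (s : Finset ι) (hs : s.card ≤ n + 1) (w : ι → ℝ) (x : ι → EuclideanSpace ℝ (Fin q))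
    (hx : ∀ i ∈ s, x i ∈ U)
    (hN : ∀ α ∈ multiIndices q (n + 1), |∑ i ∈ s, w i * monomial α (x i - c)| ≤ N) :
    |∑ i ∈ s, w i * f (x i)| ≤ (1 + 2 * q) ^ n * (ε * N) := by
  classical
  have hN0 : 0 ≤ N := (abs_nonneg _).trans (hN 0 (by simp [mem_multiIndices]))
  induction n generalizing f s w N with
  | zero =>
    rcases s.eq_empty_or_nonempty with rfl | hne
    · simpa using mul_nonneg hε hN0
    obtain ⟨i, rfl⟩ : ∃ i, s = {i} :=
      Finset.card_eq_one.1 (le_antisymm hs (Finset.card_pos.2 hne))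
    have h1 := hN 0 (by simp [mem_multiIndices])
    have h2 := hf.abs_le (x i) (hx i (by simp))
    simp only [Finset.sum_singleton, monomial_zero, mul_one] at h1 ⊢
    rw [abs_mul, pow_zero, one_mul, mul_comm]
    exact mul_le_mul h2 h1 (abs_nonneg _) hε
  | succ n ih =>
    rcases s.eq_empty_or_nonempty with rfl | ⟨i₀, hi₀⟩
    · simpa using mul_nonneg (by positivity) (mul_nonneg hε hN0)
    -- All points are contracted to x i₀. At t = 0 the sum is the total mass times f (x i₀); its
    -- derivative in t no longer involves i₀. The mean value theorem thus trades one point for one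
    -- derivative of f.
    set p : ℝ → ι → EuclideanSpace ℝ (Fin q) := fun t i => t • x i + (1 - t) • x i₀ with hp
    have hpU : ∀ t ∈ Set.Icc (0 : ℝ) 1, ∀ i ∈ s, p t i ∈ U := fun t ht i hi =>
      hUc (hx i hi) (hx i₀ hi₀) ht.1 (by linarith [ht.2]) (by ring)
    have hpd : ∀ i t, HasDerivAt (fun t => p t i) (x i - x i₀) t := by
      intro i t
      have h1 : (fun t => p t i) = fun t => x i₀ + t • (x i - x i₀) := by
        ext1 t
        simp only [hp, smul_sub, sub_smul, one_smul]
        abel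
      rw [h1]
      simpa using ((hasDerivAt_id t).smul_const (x i - x i₀)).const_add (x i₀)
    have hd : ∀ t ∈ Set.Icc (0 : ℝ) 1, HasDerivAt (fun t => ∑ i ∈ s, w i * f (p t i))
        (∑ i ∈ s, w i * fderiv ℝ f (p t i) (x i - x i₀)) t := by
      intro t ht
      refine HasDerivAt.fun_sum fun i hi => HasDerivAt.const_mul _ ?_
      exact (hf.2.1 _ (hpU t ht i hi)).hasFDerivAt.comp_hasDerivAt t (hpd i t)
    obtain ⟨τ, hτ, hslope⟩ := exists_hasDerivAt_eq_slope
      (fun t => ∑ i ∈ s, w i * f (p t i)) _ (zero_lt_one' ℝ)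
      (fun t ht => (hd t ht).continuousAt.continuousWithinAt)
      (fun t ht => hd t (Set.Ioo_subset_Icc_self ht))
    have hτ' := Set.Ioo_subset_Icc_self hτ
    have hp0 : ∀ i, p 0 i = x i₀ := fun i => by simp [hp]
    have hp1 : ∀ i, p 1 i = x i := fun i => by simp [hp]
    simp only [hp0, hp1, sub_zero, div_one, ← Finset.sum_mul] at hslope
    have hexp : ∑ i ∈ s, w i * fderiv ℝ f (p τ i) (x i - x i₀) =
        ∑ a, ∑ i ∈ s.erase i₀, (w i * (x i - x i₀) a) *
          coordDeriv a f (τ • x i + (1 - τ) • x i₀) := by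
      rw [Finset.sum_comm, ← Finset.add_sum_erase s _ hi₀]
      simp only [sub_self, map_zero, mul_zero, zero_add]
      refine Finset.sum_congr rfl fun i _ => ?_
      rw [map_eq_sum_coord, Finset.mul_sum]
      exact Finset.sum_congr rfl fun a _ => by rw [coordDeriv]; ring
    have hterm : ∀ a, |∑ i ∈ s.erase i₀, (w i * (x i - x i₀) a) *
        coordDeriv a f (τ • x i + (1 - τ) • x i₀)| ≤ (1 + 2 * q) ^ n * (ε * (2 * N)) := by
      intro a
      -- The contraction is absorbed into the function, not the points, so that the moments of the
      -- new weights are still taken at the original points; as |τ| ≤ 1 the bound ε is kept.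
      have hfa : DerivBound U n ε (fun y => coordDeriv a f (τ • y + (1 - τ) • x i₀)) := by
        have := (hf.2.2 a).comp_affine (V := U) hU hε (s := τ) (S := 1) ((1 - τ) • x i₀)
          (abs_le.2 ⟨by linarith [hτ.1], hτ.2.le⟩) le_rfl
          (fun y hy => hUc hy (hx i₀ hi₀) hτ'.1 (by linarith [hτ.2]) (by ring))
        simpa using this
      refine ih hfa (s.erase i₀) ?_ (fun i => w i * (x i - x i₀) a)
        (fun i hi => hx i (Finset.mem_of_mem_erase hi)) ?_ (by linarith)
      · rw [Finset.card_erase_of_mem hi₀]; omega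
      · intro α hα
        have hα' := mem_multiIndices.1 hα
        -- Writing x i - x i₀ = (x i - c) - (x i₀ - c) expresses each new moment through two old
        -- ones, one of them of order one higher. Since |(x i₀ - c) a| ≤ 1, the bound N becomes 2N;
        -- with q coordinates and the mass term this yields the factor 1 + 2q.
        have e : ∑ i ∈ s.erase i₀, w i * (x i - x i₀) a * monomial α (x i - c) =
            ∑ i ∈ s, w i * monomial (α + Pi.single a 1) (x i - c) -
              (x i₀ - c) a * ∑ i ∈ s, w i * monomial α (x i - c) := by
          rw [Finset.mul_sum, ← Finset.sum_sub_distrib, ← Finset.add_sum_erase s _ hi₀]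
          rw [monomial_add_single]
          have : w i₀ * ((x i₀ - c) a * monomial α (x i₀ - c)) -
            (x i₀ - c) a * (w i₀ * monomial α (x i₀ - c)) = 0 := by ring
          rw [this, zero_add]
          refine Finset.sum_congr rfl fun i _ => ?_
          rw [monomial_add_single]
          simp only [PiLp.sub_apply]
          ring
        rw [e]
        have h1 := hN (α + Pi.single a 1) (mem_multiIndices.2 (by rw [sum_add_single]; omega))
        have h2 := hN α (mem_multiIndices.2 (by omega))
        have h3 : |(x i₀ - c) a| ≤ 1 := by
          have h4 := hU1 (hx i₀ hi₀)
          rw [mem_ball_iff_norm] at h4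
          have h5 : |(x i₀ - c) a| ≤ ‖x i₀ - c‖ := by
            simpa using PiLp.norm_apply_le (x i₀ - c) a
          exact h5.trans h4.le
        refine (abs_sub _ _).trans ?_
        rw [abs_mul]
        have := mul_le_mul h3 h2 (abs_nonneg _) zero_le_one
        linarith
    have hsplit : ∑ i ∈ s, w i * f (x i) = (∑ i ∈ s, w i) * f (x i₀) +
        ∑ a, ∑ i ∈ s.erase i₀, (w i * (x i - x i₀) a) *
          coordDeriv a f (τ • x i + (1 - τ) • x i₀) := by
      rw [← hexp]; linarith
    have hfirst : |(∑ i ∈ s, w i) * f (x i₀)| ≤ N * ε := by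
      have h1 := hN 0 (by simp [mem_multiIndices])
      simp only [monomial_zero, mul_one] at h1
      rw [abs_mul]
      exact mul_le_mul h1 (hf.1 _ (hx i₀ hi₀)) (abs_nonneg _) hN0
    have hsecond := (Finset.abs_sum_le_sum_abs (fun a => ∑ i ∈ s.erase i₀,
      (w i * (x i - x i₀) a) * coordDeriv a f (τ • x i + (1 - τ) • x i₀)) Finset.univ).trans
      (Finset.sum_le_sum fun a _ => hterm a)
    rw [hsplit]
    refine (abs_add_le _ _).trans ((add_le_add hfirst hsecond).trans ?_)
    have h1 : (1 : ℝ) ≤ (1 + 2 * q) ^ n :=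
      one_le_pow₀ (by linarith [(Nat.cast_nonneg q : (0 : ℝ) ≤ q)])
    rw [pow_succ]
    simp only [Finset.sum_const, Finset.card_univ, Fintype.card_fin, nsmul_eq_mul]
    nlinarith [mul_nonneg hε hN0]

/-! ### Mass of a separated part -/

section Gap

variable {f : EuclideanSpace ℝ (Fin q) → ℝ}

lemma exists_derivBound_of_hasCompactSupport (hf : ContDiff ℝ (⊤ : ℕ∞) f)
    (hc : HasCompactSupport f) (n : ℕ) : ∃ K, 0 ≤ K ∧ DerivBound Set.univ n K f := by
  induction n generalizing f with
  | zero =>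
    obtain ⟨K, hK⟩ := hc.exists_bound_of_continuous hf.continuous
    exact ⟨K, (norm_nonneg _).trans (hK 0), fun x _ => hK x⟩
  | succ n ih =>
    obtain ⟨K, hK⟩ := hc.exists_bound_of_continuous hf.continuous
    have hK0 := (norm_nonneg _).trans (hK 0)
    have h : ∀ a, ∃ K, 0 ≤ K ∧ DerivBound Set.univ n K (coordDeriv a f) := fun a =>
      ih ((hf.fderiv_right (m := (⊤ : ℕ∞)) (by simp)).clm_apply contDiff_const)
        (hc.fderiv_apply ℝ _)
    choose B hB0 hB using h
    have hs : 0 ≤ ∑ a, B a := Finset.sum_nonneg fun a _ => hB0 a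
    refine ⟨K + ∑ a, B a, by positivity, fun x _ => (hK x).trans (by linarith),
      fun x _ => hf.differentiable (by simp) x, fun a => (hB a).mono_bound ?_⟩
    have := Finset.single_le_sum (fun b _ => hB0 b) (Finset.mem_univ a)
    linarith

lemma derivBound_prod {ι : Type*} {n : ℕ} {B : ℝ} (hB : 1 ≤ B)
    (F : ι → EuclideanSpace ℝ (Fin q) → ℝ) (s : Finset ι)
    (hF : ∀ i ∈ s, DerivBound Set.univ n B (F i)) :
    DerivBound Set.univ n ((2 ^ n * B) ^ s.card) (fun x => ∏ i ∈ s, F i x) := by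
  classical
  induction s using Finset.induction_on with
  | empty => simpa using derivBound_const Set.univ n (1 : ℝ)
  | insert a s ha ih =>
    have h := (hF a (Finset.mem_insert_self a s)).mul isOpen_univ (by linarith) (by positivity)
      (ih fun i hi => hF i (Finset.mem_insert_of_mem hi))
    rw [Finset.card_insert_of_notMem ha]
    simp only [Finset.prod_insert ha]
    exact h.mono_bound (le_of_eq (by ring))

/-- Smooth functions separating two finite families at distance at least `ρ`, with the natural
bounds for their derivatives. -/
lemma exists_separating (q n m : ℕ) : ∃ C : ℝ, 0 ≤ C ∧ ∀ {ι : Type} (s t : Finset ι)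
    (x : ι → EuclideanSpace ℝ (Fin q)) (ρ : ℝ), s.card ≤ m → 0 < ρ → ρ ≤ 1 →
      (∀ i ∈ s, ∀ j ∈ t, ρ ≤ ‖x i - x j‖) →
      ∃ f, DerivBound Set.univ n (C * ρ⁻¹ ^ n) f ∧ (∀ i ∈ s, f (x i) = 1) ∧
        ∀ j ∈ t, f (x j) = 0 := by
  let χ : ContDiffBump (0 : EuclideanSpace ℝ (Fin q)) := ⟨1 / 2, 1, by norm_num, by norm_num⟩
  obtain ⟨K, hK0, hK⟩ := exists_derivBound_of_hasCompactSupport (f := χ) χ.contDiff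
    χ.hasCompactSupport n
  set B := 1 + K with hBdef
  have hB : 1 ≤ B := by linarith
  have hB2 : (1 : ℝ) ≤ 2 ^ n * B := one_le_mul_of_one_le_of_one_le (one_le_pow₀ (by norm_num)) hB
  refine ⟨1 + (2 ^ n * B) ^ m, by positivity, fun {ι} s t x ρ hs hρ hρ1 hgap => ?_⟩
  -- The function is 1 - ∏ (1 - χ(ρ⁻¹(y - x i))) over i in s. It is assembled at unit scale, where
  -- the bounds depend only on n and m, and then composed with the dilation by ρ⁻¹, which costs ρ⁻ⁿ.
  have hfac : ∀ i ∈ s, DerivBound Set.univ n B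
      (fun y => 1 - χ ((1 : ℝ) • y + -(ρ⁻¹ • x i))) := by
    intro i _
    have h1 := (hK.comp_affine (V := Set.univ) isOpen_univ hK0 (s := 1) (S := 1) (-(ρ⁻¹ • x i))
      (by simp) le_rfl (fun _ _ => trivial)).const_mul isOpen_univ (-1)
    have h2 := (derivBound_const Set.univ n (1 : ℝ)).add isOpen_univ h1
    simpa [sub_eq_add_neg] using h2
  have hprod := ((derivBound_prod hB _ s hfac).mono_bound
    (pow_le_pow_right₀ hB2 hs)).const_mul isOpen_univ (-1)
  have hg := (derivBound_const Set.univ n (1 : ℝ)).add isOpen_univ hprod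
  have hinv : (1 : ℝ) ≤ ρ⁻¹ := (one_le_inv₀ hρ).2 hρ1
  have hf := hg.comp_affine (V := Set.univ) isOpen_univ (by positivity) (s := ρ⁻¹) (S := ρ⁻¹) 0
    (by rw [abs_of_pos (by positivity)]) hinv (fun _ _ => trivial)
  refine ⟨_, hf.mono_bound (le_of_eq (by simp)), fun i hi => ?_, fun j hj => ?_⟩
  · have h0 : ∏ k ∈ s, (1 - χ ((1 : ℝ) • (ρ⁻¹ • x i + 0) + -(ρ⁻¹ • x k))) = 0 := by
      refine Finset.prod_eq_zero hi ?_
      have : (1 : ℝ) • (ρ⁻¹ • x i + 0) + -(ρ⁻¹ • x i) = 0 := by simp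
      rw [this, χ.one_of_mem_closedBall (Metric.mem_closedBall_self (by norm_num [χ])), sub_self]
    rw [h0]; simp
  · have h1 : ∏ k ∈ s, (1 - χ ((1 : ℝ) • (ρ⁻¹ • x j + 0) + -(ρ⁻¹ • x k))) = 1 := by
      refine Finset.prod_eq_one fun k hk => ?_
      rw [χ.zero_of_le_dist, sub_zero]
      have : (1 : ℝ) • (ρ⁻¹ • x j + 0) + -(ρ⁻¹ • x k) = ρ⁻¹ • (x j - x k) := by
        rw [smul_sub, one_smul, add_zero, sub_eq_add_neg]
      rw [this, dist_zero_right, norm_smul, norm_inv, Real.norm_of_nonneg hρ.le]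
      change 1 ≤ _
      rw [← div_eq_inv_mul, one_le_div hρ, norm_sub_rev]
      exact hgap k hk j hj
    rw [h1]; norm_num

/-- A part of a discrete signed measure on at most `n + 1` points in a unit ball which is at
distance at least `ρ ≤ 1` from the rest has mass `O(ρ⁻ⁿ)` times the size of the moments of order
at most `n`. -/
theorem exists_gap_bound (q n : ℕ) : ∃ C : ℝ, 0 ≤ C ∧ ∀ {ι : Type} (s t : Finset ι)
    (w : ι → ℝ) (x : ι → EuclideanSpace ℝ (Fin q)) (c : EuclideanSpace ℝ (Fin q)) (N ρ : ℝ),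
      s.card ≤ n + 1 → t ⊆ s → 0 < ρ → ρ ≤ 1 → (∀ i ∈ s, x i ∈ Metric.ball c 1) →
      (∀ α ∈ multiIndices q (n + 1), |∑ i ∈ s, w i * monomial α (x i - c)| ≤ N) →
      (∀ i ∈ t, ∀ j ∈ s, j ∉ t → ρ ≤ ‖x i - x j‖) →
      |∑ i ∈ t, w i| * ρ ^ n ≤ C * N := by
  classical
  obtain ⟨C, hC0, hC⟩ := exists_separating q n (n + 1)
  refine ⟨(1 + 2 * q) ^ n * C, by positivity, ?_⟩
  intro ι s t w x c N ρ hs hts hρ hρ1 hx hN hgap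
  obtain ⟨f, hf, hf1, hf0⟩ := hC t (s \ t) x ρ ((Finset.card_le_card hts).trans hs) hρ hρ1
    (fun i hi j hj => hgap i hi j (Finset.mem_sdiff.1 hj).1 (Finset.mem_sdiff.1 hj).2)
  -- Composition with the identity, as an affine map, restricts the bound to the ball.
  have hfb : DerivBound (Metric.ball c 1) n (C * ρ⁻¹ ^ n) f := by
    have := hf.comp_affine (V := Metric.ball c 1) Metric.isOpen_ball (by positivity) (s := 1)
      (S := 1) 0 (by simp) le_rfl (fun _ _ => trivial)
    simpa using this
  have key := abs_sum_le_of_moments Metric.isOpen_ball (convex_ball c 1) subset_rfl hfb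
    (by positivity) s hs w x hx hN
  have e : ∑ i ∈ s, w i * f (x i) = ∑ i ∈ t, w i := by
    rw [← Finset.sum_sdiff hts]
    have h0 : ∑ i ∈ s \ t, w i * f (x i) = 0 :=
      Finset.sum_eq_zero fun i hi => by rw [hf0 i hi, mul_zero]
    rw [h0, zero_add]
    exact Finset.sum_congr rfl fun i hi => by rw [hf1 i hi, mul_one]
  rw [e] at key
  calc |∑ i ∈ t, w i| * ρ ^ n ≤ ((1 + 2 * q) ^ n * (C * ρ⁻¹ ^ n * N)) * ρ ^ n :=
        mul_le_mul_of_nonneg_right key (by positivity)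
    _ = (1 + 2 * q) ^ n * C * N * (ρ⁻¹ * ρ) ^ n := by rw [mul_pow]; ring
    _ = _ := by rw [inv_mul_cancel₀ hρ.ne', one_pow, mul_one]

end Gap

/-! ### Multi-index derivatives and Taylor remainders -/

section Taylor

variable {V : Set (EuclideanSpace ℝ (Fin q))} {f g : EuclideanSpace ℝ (Fin q) → ℝ}

/-- The iterated coordinate derivative along a list of coordinates. -/
def listDeriv (L : List (Fin q)) (f : EuclideanSpace ℝ (Fin q) → ℝ) :
    EuclideanSpace ℝ (Fin q) → ℝ := L.foldr coordDeriv f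

lemma coordDeriv_eqOn (hV : IsOpen V) (h : Set.EqOn f g V) (a : Fin q) :
    Set.EqOn (coordDeriv a f) (coordDeriv a g) V := fun x hx => by
  have : f =ᶠ[𝓝 x] g := (hV.eventually_mem hx).mono fun y hy => h hy
  rw [coordDeriv, coordDeriv, this.fderiv_eq]

lemma contDiffOn_coordDeriv (hV : IsOpen V) {n : ℕ} (hf : ContDiffOn ℝ (n + 1 : ℕ) f V)
    (a : Fin q) : ContDiffOn ℝ n (coordDeriv a f) V :=
  (hf.fderiv_of_isOpen hV (by norm_cast)).clm_apply contDiffOn_const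

lemma contDiffOn_listDeriv (hV : IsOpen V) (L : List (Fin q)) {n : ℕ}
    (hf : ContDiffOn ℝ (n + L.length : ℕ) f V) : ContDiffOn ℝ n (listDeriv L f) V := by
  induction L generalizing n with
  | nil => simpa [listDeriv] using hf
  | cons a L ih =>
    refine contDiffOn_coordDeriv hV (ih ?_) a
    convert hf using 2
    simp only [List.length_cons]; omega

lemma coordDeriv_comm (hV : IsOpen V) (hf : ContDiffOn ℝ 2 f V) (a b : Fin q) :
    Set.EqOn (coordDeriv a (coordDeriv b f)) (coordDeriv b (coordDeriv a f)) V := fun x hx => by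
  have hfx : ContDiffAt ℝ 2 f x := hf.contDiffAt (hV.mem_nhds hx)
  have hd : DifferentiableAt ℝ (fderiv ℝ f) x :=
    (hfx.fderiv_right (m := 1) (by norm_num)).differentiableAt (by norm_num)
  have h : ∀ a b, coordDeriv a (coordDeriv b f) x =
      fderiv ℝ (fderiv ℝ f) x (EuclideanSpace.single a 1) (EuclideanSpace.single b 1) := by
    intro a b
    have : coordDeriv b f = fun y => fderiv ℝ f y (EuclideanSpace.single b 1) := rfl
    rw [coordDeriv, this, fderiv_clm_apply hd (differentiableAt_const _)]
    simp
  rw [h, h]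
  exact hfx.isSymmSndFDerivAt (by simp) _ _

lemma listDeriv_perm (hV : IsOpen V) {L L' : List (Fin q)} (h : L.Perm L')
    (hf : ContDiffOn ℝ L.length f V) : Set.EqOn (listDeriv L f) (listDeriv L' f) V := by
  induction h with
  | nil => exact fun _ _ => rfl
  | cons a _ ih =>
    exact coordDeriv_eqOn hV (ih (hf.of_le (by simp))) a
  | swap a b L =>
    refine coordDeriv_comm hV (contDiffOn_listDeriv hV L (n := 2) ?_) b a
    convert hf using 2
    simp only [List.length_cons]; omega
  | trans h₁ _ ih₁ ih₂ => exact (ih₁ hf).trans (ih₂ (h₁.length_eq ▸ hf))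

lemma iteratedFDeriv_eq_listDeriv (hV : IsOpen V) (L : List (Fin q))
    (hf : ContDiffOn ℝ L.length f V) : Set.EqOn
      (fun x => iteratedFDeriv ℝ L.length f x fun j => EuclideanSpace.single (L.get j) (1 : ℝ))
      (listDeriv L f) V := by
  induction L with
  | nil => intro x _; simp [listDeriv]
  | cons a L ih =>
    intro x hx
    have hfx : ContDiffAt ℝ (L.length + 1 : ℕ) f x := hf.contDiffAt (hV.mem_nhds hx)
    have hd : DifferentiableAt ℝ (iteratedFDeriv ℝ L.length f) x :=
      hfx.differentiableAt_iteratedFDeriv (by exact_mod_cast Nat.lt_succ_self _)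
    have h1 := coordDeriv_eqOn hV (ih (hf.of_le (by simp))) a hx
    change _ = coordDeriv a (listDeriv L f) x
    rw [← h1, coordDeriv]
    simp only [List.length_cons]
    rw [iteratedFDeriv_succ_apply_left, fderiv_continuousMultilinear_apply_const_apply hd]
    rfl

lemma count_directions (α : Fin q → ℕ) (a : Fin q) : (directions α).count a = α a := by
  simp only [directions, List.count_flatMap, Function.comp_def, List.count_replicate]
  rw [← List.ofFn_eq_map, List.sum_ofFn]
  simp

lemma length_directions (α : Fin q → ℕ) : (directions α).length = ∑ i, α i := by
  simp only [directions, List.length_flatMap, List.length_replicate]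
  rw [← List.ofFn_eq_map, List.sum_ofFn]

lemma partialDeriv_eq_listDeriv (hV : IsOpen V) (α : Fin q → ℕ)
    (hf : ContDiffOn ℝ (∑ i, α i : ℕ) f V) :
    Set.EqOn (partialDeriv α f) (listDeriv (directions α) f) V :=
  iteratedFDeriv_eq_listDeriv hV _ (by rwa [length_directions])

/-- On the left the derivative in direction a is taken first, on the right in the order fixed by
`directions`. Both lists of coordinates have the same counts, and symmetry of second derivatives
makes the order immaterial. -/
lemma partialDeriv_coordDeriv (hV : IsOpen V) (α : Fin q → ℕ) (a : Fin q)
    (hf : ContDiffOn ℝ (∑ i, α i + 1 : ℕ) f V) :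
    Set.EqOn (partialDeriv α (coordDeriv a f)) (partialDeriv (α + Pi.single a 1) f) V := by
  have hperm : (directions α ++ [a]).Perm (directions (α + Pi.single a 1)) := by
    rw [List.perm_iff_count]
    intro b
    rw [List.count_append, count_directions, count_directions, List.count_singleton]
    by_cases h : a = b
    · subst h; simp
    · simp [h, Ne.symm h]
  intro x hx
  rw [partialDeriv_eq_listDeriv hV α (contDiffOn_coordDeriv hV hf a) hx,
    partialDeriv_eq_listDeriv hV _ (by rwa [sum_add_single]) hx,
    ← listDeriv_perm hV hperm (by simpa [length_directions] using hf) hx]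
  simp [listDeriv]

/-- The polynomial with derivatives `c α`, `|α| ≤ n`, at `θ`. -/
def taylorPoly (n : ℕ) (c : (Fin q → ℕ) → ℝ) (θ x : EuclideanSpace ℝ (Fin q)) : ℝ :=
  ∑ α ∈ multiIndices q (n + 1), c α / (∏ i, ((α i).factorial : ℝ)) * monomial α (x - θ)

lemma differentiable_monomial (α : Fin q → ℕ) (θ : EuclideanSpace ℝ (Fin q)) :
    Differentiable ℝ (fun x => monomial α (x - θ)) := by
  unfold monomial
  fun_prop

lemma coordDeriv_monomial (α : Fin q → ℕ) (a : Fin q) (θ x : EuclideanSpace ℝ (Fin q)) :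
    coordDeriv a (fun x => monomial α (x - θ)) x =
      α a * ((x - θ) a ^ (α a - 1) * ∏ b ∈ Finset.univ.erase a, (x - θ) b ^ α b) := by
  have hl : HasDerivAt (fun t : ℝ => x + t • EuclideanSpace.single a (1 : ℝ))
      (EuclideanSpace.single a 1) 0 := by
    simpa using ((hasDerivAt_id (0 : ℝ)).smul_const (EuclideanSpace.single a (1 : ℝ))).const_add x
  have hd : HasFDerivAt (fun x => monomial α (x - θ))
      (fderiv ℝ (fun x => monomial α (x - θ)) x)
      (x + (0 : ℝ) • EuclideanSpace.single a (1 : ℝ)) := by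
    simpa using (differentiable_monomial α θ x).hasFDerivAt
  have h1 := hd.comp_hasDerivAt (0 : ℝ) hl
  have e : ((fun x => monomial α (x - θ)) ∘ fun t : ℝ => x + t • EuclideanSpace.single a (1 : ℝ)) =
      fun t => ((x - θ) a + t) ^ α a * ∏ b ∈ Finset.univ.erase a, (x - θ) b ^ α b := by
    ext t
    simp only [Function.comp, monomial]
    rw [← Finset.mul_prod_erase _ _ (Finset.mem_univ a)]
    congr 1
    · simp; ring
    · refine Finset.prod_congr rfl fun b hb => ?_
      simp [Finset.ne_of_mem_erase hb]
  have h2 : HasDerivAt (fun t : ℝ => ((x - θ) a + t) ^ α a *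
      ∏ b ∈ Finset.univ.erase a, (x - θ) b ^ α b)
      (α a * ((x - θ) a ^ (α a - 1) * ∏ b ∈ Finset.univ.erase a, (x - θ) b ^ α b)) 0 := by
    have := ((((hasDerivAt_id (0 : ℝ)).const_add ((x - θ) a)).pow (α a)).mul_const
      (∏ b ∈ Finset.univ.erase a, (x - θ) b ^ α b))
    simpa [mul_assoc] using this
  rw [e] at h1
  exact h1.unique h2

lemma coordDeriv_monomial_zero {α : Fin q → ℕ} {a : Fin q} (h : α a = 0)
    (θ x : EuclideanSpace ℝ (Fin q)) : coordDeriv a (fun x => monomial α (x - θ)) x = 0 := by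
  rw [coordDeriv_monomial, h]; simp

lemma coordDeriv_monomial_add_single (α : Fin q → ℕ) (a : Fin q)
    (θ x : EuclideanSpace ℝ (Fin q)) :
    coordDeriv a (fun x => monomial (α + Pi.single a 1) (x - θ)) x =
      (α a + 1) * monomial α (x - θ) := by
  rw [coordDeriv_monomial, monomial, ← Finset.mul_prod_erase _ _ (Finset.mem_univ a)]
  congr 1
  · simp
  · congr 1
    · simp
    · refine Finset.prod_congr rfl fun b hb => ?_
      simp [Finset.ne_of_mem_erase hb]

lemma prod_factorial_add_single (α : Fin q → ℕ) (a : Fin q) :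
    (∏ i, (((α + Pi.single a 1 : Fin q → ℕ) i).factorial : ℝ)) =
      (α a + 1) * ∏ i, ((α i).factorial : ℝ) := by
  rw [← Finset.mul_prod_erase _ _ (Finset.mem_univ a),
    ← Finset.mul_prod_erase Finset.univ (fun i => ((α i).factorial : ℝ)) (Finset.mem_univ a),
    ← mul_assoc]
  congr 1
  · simp [Nat.factorial_succ]
  · refine Finset.prod_congr rfl fun b hb => ?_
    simp [Finset.ne_of_mem_erase hb]

lemma differentiable_taylorPoly (n : ℕ) (c : (Fin q → ℕ) → ℝ) (θ : EuclideanSpace ℝ (Fin q)) :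
    Differentiable ℝ (taylorPoly n c θ) := by
  unfold taylorPoly
  exact Differentiable.fun_sum fun α _ => (differentiable_monomial α θ).const_mul _

/-- Differentiation shifts the coefficient family, so Taylor remainders of order n + 1 differentiate
to Taylor remainders of order n. -/
lemma coordDeriv_taylorPoly (n : ℕ) (c : (Fin q → ℕ) → ℝ) (a : Fin q)
    (θ x : EuclideanSpace ℝ (Fin q)) :
    coordDeriv a (taylorPoly (n + 1) c θ) x =
      taylorPoly n (fun α => c (α + Pi.single a 1)) θ x := by
  have h1 : coordDeriv a (taylorPoly (n + 1) c θ) x = ∑ α ∈ multiIndices q (n + 1 + 1),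
      c α / (∏ i, ((α i).factorial : ℝ)) * coordDeriv a (fun x => monomial α (x - θ)) x := by
    unfold taylorPoly coordDeriv
    rw [fderiv_fun_sum fun α _ => ((differentiable_monomial α θ).const_mul _) x]
    simp only [_root_.sum_apply]
    refine Finset.sum_congr rfl fun α _ => ?_
    rw [fderiv_const_mul (differentiable_monomial α θ x)]
    simp
  rw [h1, taylorPoly]
  symm
  refine Finset.sum_of_injOn (fun α => α + Pi.single a 1) ?_ ?_ ?_ ?_
  · exact fun α _ β _ h => add_right_cancel h
  · intro α hα
    have := mem_multiIndices.1 hα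
    exact mem_multiIndices.2 (by rw [sum_add_single]; omega)
  · intro α hα hα'
    rw [coordDeriv_monomial_zero, mul_zero]
    by_contra h
    refine hα' ⟨α - Pi.single a 1, ?_, ?_⟩
    · have hle : Pi.single a 1 ≤ α := by
        intro b
        by_cases hb : b = a
        · subst hb; simp; omega
        · simp [hb]
      have e := sum_add_single (α - Pi.single a 1) a
      rw [tsub_add_cancel_of_le hle] at e
      have := mem_multiIndices.1 hα
      exact mem_multiIndices.2 (by omega)
    · ext b
      by_cases hb : b = a
      · subst hb; simp; omega
      · simp [hb]
  · intro α _
    rw [coordDeriv_monomial_add_single, prod_factorial_add_single]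
    have h2 : ((α a : ℝ) + 1) ≠ 0 := by positivity
    have h3 : (∏ i, ((α i).factorial : ℝ)) ≠ 0 :=
      Finset.prod_ne_zero_iff.2 fun i _ => by positivity
    field_simp

lemma taylorPoly_self (n : ℕ) (c : (Fin q → ℕ) → ℝ) (θ : EuclideanSpace ℝ (Fin q)) :
    taylorPoly n c θ θ = c 0 := by
  rw [taylorPoly, Finset.sum_eq_single 0]
  · simp
  · intro α _ hα
    obtain ⟨b, hb⟩ : ∃ b, α b ≠ 0 := by
      by_contra! h
      exact hα (funext h)
    have : monomial α (θ - θ) = 0 :=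
      Finset.prod_eq_zero (Finset.mem_univ b) (by simp [hb])
    rw [this, mul_zero]
  · intro h
    exact absurd (mem_multiIndices.2 (by simp)) h

/-- The remainder of Taylor's formula of order `n` is small near the base point together with its
derivatives of order at most `n`. -/
theorem exists_derivBound_taylor (hV : IsOpen V) {θ : EuclideanSpace ℝ (Fin q)} (hθ : θ ∈ V)
    {n : ℕ} (hf : ContDiffOn ℝ n f V) {ε : ℝ} (hε : 0 < ε) :
    ∃ δ > 0, δ ≤ 1 ∧ DerivBound (Metric.ball θ δ) n ε
      (fun x => f x - taylorPoly n (fun α => partialDeriv α f θ) θ x) := by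
  -- The coefficients are a free family so that the shifted family c(α + e_a) fits the induction.
  -- The statement for all small radii lets the radii of the finitely many coordinate derivatives be
  -- combined.
  have main : ∀ c : (Fin q → ℕ) → ℝ, (∀ α ∈ multiIndices q (n + 1), c α = partialDeriv α f θ) →
      ∀ᶠ δ in 𝓝[>] (0 : ℝ), DerivBound (Metric.ball θ δ) n ε
        (fun x => f x - taylorPoly n c θ x) := by
    induction n generalizing f with
    | zero =>
      intro c hc
      have hcont : ContinuousAt (fun x => f x - taylorPoly 0 c θ x) θ :=
        (hf.continuousOn.continuousAt (hV.mem_nhds hθ)).sub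
          (differentiable_taylorPoly 0 c θ).continuous.continuousAt
      have h0 : f θ - taylorPoly 0 c θ θ = 0 := by
        rw [taylorPoly_self, hc 0 (mem_multiIndices.2 (by simp)),
          partialDeriv_eq_listDeriv hV 0 (by simpa using hf) hθ]
        have : directions (0 : Fin q → ℕ) = [] := by
          rw [← List.length_eq_zero_iff, length_directions]; simp
        simp [this, listDeriv]
      obtain ⟨δ, hδ, hb⟩ := Metric.continuousAt_iff.1 hcont ε hε
      filter_upwards [Ioo_mem_nhdsGT hδ] with r hr x hx
      have := hb ((Metric.mem_ball.1 hx).trans hr.2)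
      rw [h0, Real.dist_eq, sub_zero] at this
      exact this.le
    | succ n ih =>
      intro c hc
      have hcont : ContinuousAt (fun x => f x - taylorPoly (n + 1) c θ x) θ :=
        (hf.continuousOn.continuousAt (hV.mem_nhds hθ)).sub
          (differentiable_taylorPoly (n + 1) c θ).continuous.continuousAt
      have h0 : f θ - taylorPoly (n + 1) c θ θ = 0 := by
        rw [taylorPoly_self, hc 0 (mem_multiIndices.2 (by simp)),
          partialDeriv_eq_listDeriv hV 0 (hf.of_le (by simp)) hθ]
        have : directions (0 : Fin q → ℕ) = [] := by
          rw [← List.length_eq_zero_iff, length_directions]; simp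
        simp [this, listDeriv]
      obtain ⟨δ, hδ, hb⟩ := Metric.continuousAt_iff.1 hcont ε hε
      obtain ⟨δ', hδ', hV'⟩ := Metric.isOpen_iff.1 hV θ hθ
      have hrec : ∀ a, ∀ᶠ δ in 𝓝[>] (0 : ℝ), DerivBound (Metric.ball θ δ) n ε
          (fun x => coordDeriv a f x - taylorPoly n (fun α => c (α + Pi.single a 1)) θ x) := by
        intro a
        refine ih (contDiffOn_coordDeriv hV hf a) _ fun α hα => ?_
        have hα' := mem_multiIndices.1 hα
        rw [hc _ (mem_multiIndices.2 (by rw [sum_add_single]; omega)),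
          partialDeriv_coordDeriv hV α a (hf.of_le (by exact_mod_cast hα')) hθ]
      filter_upwards [Ioo_mem_nhdsGT hδ, Ioo_mem_nhdsGT hδ', eventually_all.2 hrec]
        with r hr hr' hrec
      have hfd : ∀ x ∈ Metric.ball θ r, DifferentiableAt ℝ f x := fun x hx =>
        (hf.contDiffAt (hV.mem_nhds (hV' (Metric.ball_subset_ball hr'.2.le hx)))).differentiableAt
          (by simp)
      refine ⟨fun x hx => ?_, fun x hx =>
        (hfd x hx).sub (differentiable_taylorPoly (n + 1) c θ x), fun a => ?_⟩
      · have := hb ((Metric.mem_ball.1 hx).trans hr.2)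
        rw [h0, Real.dist_eq, sub_zero] at this
        exact this.le
      · refine (hrec a).congr Metric.isOpen_ball fun x hx => ?_
        rw [← coordDeriv_taylorPoly]
        simp only [coordDeriv]
        rw [fderiv_fun_sub (hfd x hx) (differentiable_taylorPoly (n + 1) c θ x)]
        simp
  obtain ⟨δ, hδ, hδ0⟩ := ((main _ fun _ _ => rfl).and (Ioo_mem_nhdsGT one_pos)).exists
  exact ⟨δ, hδ0.1, hδ0.2.le, hδ⟩

end Taylor

/-! ### Greedy transport -/

section Transport

variable {ι : Type*} {z : ι → EuclideanSpace ℝ (Fin q)}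

/-- Within the labels satisfying `T`, the points of `A` are at distance at least `ρ` from the
others. -/
def IsGap (z : ι → EuclideanSpace ℝ (Fin q)) (T : ι → Prop) (A : Finset ι) (ρ : ℝ) : Prop :=
  ∀ i ∈ A, ∀ j, j ∉ A → T i → T j → ρ ≤ ‖z i - z j‖

/-- A massless point i is put on the side of A if some point of A satisfying T is closer than ρ/2,
and on the other side otherwise. The triangle inequality leaves a gap of ρ/2, and no mass changes.
-/
lemma IsGap.exists_insert [DecidableEq ι] {w : ι → ℝ} {T : ι → Prop} {A : Finset ι} {ρ : ℝ}
    (hρ : 0 ≤ ρ) (h : IsGap z T A ρ) (hw : ∀ k, ¬ T k → w k = 0) (i : ι) :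
    ∃ A', IsGap z (fun k => k = i ∨ T k) A' (ρ / 2) ∧ ∑ k ∈ A', w k = ∑ k ∈ A, w k := by
  by_cases hi : T i
  · refine ⟨A, fun k hk l hl hTk hTl => ?_, rfl⟩
    have hTk' : T k := by rcases hTk with rfl | h <;> assumption
    have hTl' : T l := by rcases hTl with rfl | h <;> assumption
    linarith [h k hk l hl hTk' hTl']
  by_cases hc : ∃ k ∈ A, T k ∧ ‖z k - z i‖ < ρ / 2
  · obtain ⟨a, ha, hTa, hd⟩ := hc
    refine ⟨insert i A, fun k hk l hl hTk hTl => ?_, ?_⟩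
    · rw [Finset.mem_insert, not_or] at hl
      have hTl' : T l := hTl.resolve_left hl.1
      by_cases hki : k = i
      · subst hki
        have h1 := h a ha l hl.2 hTa hTl'
        have h2 := norm_sub_le_norm_sub_add_norm_sub (z a) (z k) (z l)
        linarith
      · have hkA := (Finset.mem_insert.1 hk).resolve_left hki
        linarith [h k hkA l hl.2 (hTk.resolve_left hki) hTl']
    · by_cases hiA : i ∈ A
      · rw [Finset.insert_eq_self.2 hiA]
      · rw [Finset.sum_insert hiA, hw i hi, zero_add]
  · push Not at hc
    refine ⟨A.erase i, fun k hk l hl hTk hTl => ?_, ?_⟩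
    · rw [Finset.mem_erase] at hk
      have hTk' : T k := hTk.resolve_left hk.1
      by_cases hli : l = i
      · subst hli
        exact hc k hk.2 hTk'
      · have hlA : l ∉ A := fun h => hl (Finset.mem_erase.2 ⟨hli, h⟩)
        linarith [h k hk.2 l hlA hTk' (hTl.resolve_left hli)]
    · by_cases hiA : i ∈ A
      · rw [← Finset.add_sum_erase A w hiA, hw i hi, zero_add]
      · rw [Finset.erase_eq_of_notMem hiA]

/-- If every part of a signed measure of total mass `0` has mass `O(ρ⁻ʳ)`, where `ρ` is its
distance from the rest, then the positive part can be transported to the negative part at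
cost `O(1)`. -/
theorem exists_transport [Fintype ι] [DecidableEq ι] {r : ℕ} (hr : r ≠ 0) {D : ℝ} (hD : 1 ≤ D)
    (hzD : ∀ i j, ‖z i - z j‖ ≤ D) (n : ℕ) (w : ι → ℝ) (K : ℝ)
    (hn : (Finset.univ.filter fun i => w i ≠ 0).card ≤ n) (hw : ∑ i, w i = 0)
    (hK : ∀ (A : Finset ι) (ρ : ℝ), 0 < ρ → ρ ≤ 1 → IsGap z (fun i => w i ≠ 0) A ρ →
      |∑ i ∈ A, w i| * ρ ^ r ≤ K) :
    ∃ c : ι → ι → ℝ, (∀ i j, 0 ≤ c i j) ∧ (∀ i, ∑ j, c i j = max (w i) 0) ∧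
      (∀ j, ∑ i, c i j = max (-w j) 0) ∧
      ∑ i, ∑ j, c i j * ‖z i - z j‖ ^ r ≤ (4 * 4 ^ r) ^ n * (D ^ r * K) := by
  have hK0 : 0 ≤ K := by
    have := hK ∅ 1 one_pos le_rfl (fun i hi => absurd hi (Finset.notMem_empty i))
    simpa using this
  induction n generalizing w K with
  | zero =>
    have h0 : ∀ i, w i = 0 := by
      intro i
      by_contra h
      have : i ∈ Finset.univ.filter fun i => w i ≠ 0 := by simpa using h
      exact absurd (Finset.card_pos.2 ⟨i, this⟩) (by omega)
    exact ⟨fun _ _ => 0, by simp, by simp [h0], by simp [h0], by simpa using by positivity⟩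
  | succ n ih =>
    by_cases hpos : ∃ i, 0 < w i
    swap
    · push Not at hpos
      have h0 : ∀ i, w i = 0 := fun i =>
        (Finset.sum_eq_zero_iff_of_nonpos fun i _ => hpos i).1 hw i (Finset.mem_univ i)
      exact ⟨fun _ _ => 0, by simp, by simp [h0], by simp [h0], by simpa using by positivity⟩
    have hneg : ∃ j, w j < 0 := by
      by_contra! h
      obtain ⟨i, hi⟩ := hpos
      exact hi.ne' ((Finset.sum_eq_zero_iff_of_nonneg fun i _ => h i).1 hw i (Finset.mem_univ i))
    -- The greedy step: as much mass t as possible moves between a closest pair of opposite signs.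
    -- This kills at least one label, so the induction on the size of the support proceeds.
    obtain ⟨⟨i, j⟩, hij, hmin⟩ := Finset.exists_min_image
      ((Finset.univ.filter fun i => 0 < w i) ×ˢ (Finset.univ.filter fun j => w j < 0))
      (fun p => ‖z p.1 - z p.2‖)
      (by
        obtain ⟨i, hi⟩ := hpos
        obtain ⟨j, hj⟩ := hneg
        exact ⟨(i, j), by simp [hi, hj]⟩)
    simp only [Finset.mem_product, Finset.mem_filter, Finset.mem_univ, true_and] at hij hmin
    obtain ⟨hi, hj⟩ := hij
    have hmin' : ∀ k l, 0 < w k → w l < 0 → ‖z i - z j‖ ≤ ‖z k - z l‖ :=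
      fun k l hk hl => hmin (k, l) ⟨hk, hl⟩
    have hne : i ≠ j := by rintro rfl; linarith
    set d := ‖z i - z j‖ with hd
    set t := min (w i) (-w j) with ht
    have ht0 : 0 < t := lt_min hi (by linarith)
    have hti : t ≤ w i := min_le_left _ _
    have htj : t ≤ -w j := min_le_right _ _
    have hd0 : 0 ≤ d := norm_nonneg _
    -- By minimality of d the positive labels are at distance at least d from the negative ones;
    -- their mass is at least t, so the gap hypothesis applies to them.
    have hstep : ∀ ρ, 0 ≤ ρ → ρ ≤ 1 → ρ ≤ d → t * ρ ^ r ≤ K := by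
      intro ρ hρ hρ1 hρd
      rcases hρ.eq_or_lt with rfl | hρ
      · simpa [hr] using hK0
      have h1 := hK (Finset.univ.filter fun i => 0 < w i) ρ hρ hρ1 (by
        intro k hk l hl hk0 hl0
        simp only [Finset.mem_filter, Finset.mem_univ, true_and, not_lt] at hk hl
        exact hρd.trans (hmin' k l hk (lt_of_le_of_ne hl hl0)))
      have h2 : t ≤ ∑ k ∈ Finset.univ.filter fun i => 0 < w i, w k := by
        refine hti.trans (Finset.single_le_sum (f := w) (fun k hk => ?_) (by simp [hi]))
        exact (Finset.mem_filter.1 hk).2.le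
      exact (mul_le_mul_of_nonneg_right (h2.trans (le_abs_self _)) (by positivity)).trans h1
    set w' : ι → ℝ := fun k => w k - (if k = i then t else 0) + (if k = j then t else 0) with hw'
    have hw'i : w' i = w i - t := by simp [hw', hne]
    have hw'j : w' j = w j + t := by simp [hw', hne.symm]
    have hw'k : ∀ k, k ≠ i → k ≠ j → w' k = w k := fun k h1 h2 => by simp [hw', h1, h2]
    have hsupp : ∀ k, w' k ≠ 0 → w k ≠ 0 := by
      intro k hk
      by_cases h1 : k = i
      · subst h1; exact hi.ne'
      by_cases h2 : k = j
      · subst h2; exact hj.ne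
      rwa [hw'k k h1 h2] at hk
    have hcard : (Finset.univ.filter fun i => w' i ≠ 0).card ≤ n := by
      have : (Finset.univ.filter fun i => w' i ≠ 0) ⊂ (Finset.univ.filter fun i => w i ≠ 0) := by
        rw [Finset.ssubset_iff_of_subset (fun k hk => by
          simp only [Finset.mem_filter, Finset.mem_univ, true_and] at hk ⊢
          exact hsupp k hk)]
        rcases le_total (w i) (-w j) with h | h
        · refine ⟨i, by simp [hi.ne'], ?_⟩
          have : t = w i := min_eq_left h
          simp [hw'i, this]
        · refine ⟨j, by simp [hj.ne], ?_⟩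
          have : t = -w j := min_eq_right h
          simp [hw'j, this]
      have := Finset.card_lt_card this
      omega
    have hw'sum : ∀ A : Finset ι, ∑ k ∈ A, w' k =
        ∑ k ∈ A, w k - (if i ∈ A then t else 0) + (if j ∈ A then t else 0) := by
      intro A
      simp only [hw', Finset.sum_add_distrib, Finset.sum_sub_distrib, Finset.sum_ite_eq']
    -- A gap for w' may ignore i or j when they have lost their mass. Reinserting both leaves a gap
    -- ρ/4 for w, whence 4ʳ. The mass of the part changes by t only if the gap separates i from j,
    -- and then `hstep` bounds this change by another K, whence the 2.
    have hK' : ∀ (A : Finset ι) (ρ : ℝ), 0 < ρ → ρ ≤ 1 → IsGap z (fun i => w' i ≠ 0) A ρ →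
        |∑ i ∈ A, w' i| * ρ ^ r ≤ 2 * 4 ^ r * K := by
      intro A ρ hρ hρ1 hA
      obtain ⟨A₁, hA₁, hs₁⟩ := hA.exists_insert (w := w') hρ.le (fun k hk => not_not.1 hk) i
      obtain ⟨A₂, hA₂, hs₂⟩ := hA₁.exists_insert (w := w') (by positivity)
        (fun k hk => not_not.1 (not_or.1 hk).2) j
      have hgap : IsGap z (fun k => w k ≠ 0) A₂ (ρ / 4) := by
        have hT : ∀ k, w k ≠ 0 → (k = j ∨ k = i ∨ w' k ≠ 0) := by
          intro k hk
          by_cases h1 : k = i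
          · exact Or.inr (Or.inl h1)
          by_cases h2 : k = j
          · exact Or.inl h2
          exact Or.inr (Or.inr (by rwa [hw'k k h1 h2]))
        intro k hk l hl hk0 hl0
        have := hA₂ k hk l hl (hT k hk0) (hT l hl0)
        linarith
      have h1 := hK A₂ (ρ / 4) (by positivity) (by linarith) hgap
      have h2 : |∑ k ∈ A₂, w' k| * (ρ / 4) ^ r ≤ 2 * K := by
        rw [hw'sum]
        have hdsym : ‖z j - z i‖ = d := by rw [norm_sub_rev]
        by_cases hiA : i ∈ A₂ <;> by_cases hjA : j ∈ A₂
        · simp only [hiA, hjA, if_true, sub_add_cancel]; linarith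
        · have h3 := hstep (ρ / 4) (by positivity) (by linarith) (hgap i hiA j hjA hi.ne' hj.ne)
          have h4 : |∑ k ∈ A₂, w k - t + 0| ≤ |∑ k ∈ A₂, w k| + t := by
            rw [add_zero]
            exact (abs_sub _ _).trans (by rw [abs_of_pos ht0])
          simp only [hiA, hjA, if_true, if_false]
          nlinarith [mul_le_mul_of_nonneg_right h4 (by positivity : 0 ≤ (ρ / 4) ^ r)]
        · have h3 := hstep (ρ / 4) (by positivity) (by linarith)
            (hdsym ▸ hgap j hjA i hiA hj.ne hi.ne')
          have h4 : |∑ k ∈ A₂, w k - 0 + t| ≤ |∑ k ∈ A₂, w k| + t := by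
            rw [sub_zero]
            exact (abs_add_le _ _).trans (by rw [abs_of_pos ht0])
          simp only [hiA, hjA, if_true, if_false]
          nlinarith [mul_le_mul_of_nonneg_right h4 (by positivity : 0 ≤ (ρ / 4) ^ r)]
        · simp only [hiA, hjA, if_false, sub_zero, add_zero]; linarith
      rw [← hs₁, ← hs₂]
      calc |∑ k ∈ A₂, w' k| * ρ ^ r = 4 ^ r * (|∑ k ∈ A₂, w' k| * (ρ / 4) ^ r) := by
            rw [div_pow]; field_simp
        _ ≤ 4 ^ r * (2 * K) := mul_le_mul_of_nonneg_left h2 (by positivity)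
        _ = _ := by ring
    have hw'0 : ∑ k, w' k = 0 := by rw [hw'sum]; simp [hw]
    obtain ⟨c, hc0, hc1, hc2, hc3⟩ := ih w' (2 * 4 ^ r * K) hcard hw'0 hK' (by positivity)
    refine ⟨fun k l => c k l + if k = i ∧ l = j then t else 0, fun k l => ?_, fun k => ?_,
      fun l => ?_, ?_⟩
    · refine add_nonneg (hc0 k l) ?_
      split_ifs
      exacts [ht0.le, le_rfl]
    · rw [Finset.sum_add_distrib, hc1]
      by_cases h1 : k = i
      · subst h1
        simp only [true_and, Finset.sum_ite_eq', Finset.mem_univ, if_true]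
        rw [hw'i, max_eq_left (by linarith), max_eq_left hi.le]; ring
      · simp only [h1, false_and, if_false, Finset.sum_const_zero, add_zero]
        by_cases h2 : k = j
        · subst h2
          rw [hw'j, max_eq_right (by linarith), max_eq_right hj.le]
        · rw [hw'k k h1 h2]
    · rw [Finset.sum_add_distrib, hc2]
      by_cases h1 : l = j
      · subst h1
        simp only [and_true, Finset.sum_ite_eq', Finset.mem_univ, if_true]
        rw [hw'j, max_eq_left (by linarith), max_eq_left (by linarith)]; ring
      · simp only [h1, and_false, if_false, Finset.sum_const_zero, add_zero]
        by_cases h2 : l = i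
        · subst h2
          rw [hw'i, max_eq_right (by linarith), max_eq_right (by linarith)]
        · rw [hw'k l h2 h1]
    · have e : ∑ k, ∑ l, (c k l + if k = i ∧ l = j then t else 0) * ‖z k - z l‖ ^ r =
          ∑ k, ∑ l, c k l * ‖z k - z l‖ ^ r + t * d ^ r := by
        simp only [add_mul, Finset.sum_add_distrib]
        congr 1
        rw [Finset.sum_eq_single i (fun k _ hk => by simp [hk]) (by simp),
          Finset.sum_eq_single j (fun l _ hl => by simp [hl]) (by simp)]
        simp [hd]
      -- The gap hypothesis only concerns ρ ≤ 1; the diameter bound D makes up for d > 1.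
      have hdmin : t * d ^ r ≤ D ^ r * K := by
        have h1 := hstep (min d 1) (le_min hd0 zero_le_one) (min_le_right _ _) (min_le_left _ _)
        have h2 : d ≤ D * min d 1 := by
          rcases le_total d 1 with h | h
          · rw [min_eq_left h]; nlinarith
          · rw [min_eq_right h, mul_one]; exact hzD i j
        calc t * d ^ r ≤ t * (D * min d 1) ^ r :=
              mul_le_mul_of_nonneg_left (pow_le_pow_left₀ hd0 h2 r) ht0.le
          _ = D ^ r * (t * min d 1 ^ r) := by rw [mul_pow]; ring
          _ ≤ D ^ r * K := mul_le_mul_of_nonneg_left h1 (by positivity)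
      rw [e]
      have hDK : 0 ≤ D ^ r * K := by positivity
      have h4 : (1 : ℝ) ≤ 4 ^ r := one_le_pow₀ (by norm_num)
      have hM : (1 : ℝ) ≤ (4 * 4 ^ r) ^ n := one_le_pow₀ (by linarith)
      have hX : D ^ r * K ≤ (4 * 4 ^ r) ^ n * (2 * 4 ^ r) * (D ^ r * K) :=
        le_mul_of_one_le_left hDK (one_le_mul_of_one_le_of_one_le hM (by linarith))
      calc _ ≤ (4 * 4 ^ r) ^ n * (D ^ r * (2 * 4 ^ r * K)) + D ^ r * K := add_le_add hc3 hdmin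
        _ ≤ (4 * 4 ^ r) ^ n * (2 * 4 ^ r) * (D ^ r * K) +
            (4 * 4 ^ r) ^ n * (2 * 4 ^ r) * (D ^ r * K) :=
          add_le_add (le_of_eq (by ring)) hX
        _ = _ := by rw [pow_succ]; ring

end Transport

/-! ### Elementary bounds for the Wasserstein distance -/

section Wasserstein

variable {G H : DiscreteProb q} {r : ℕ}

lemma sum_weights (G : DiscreteProb q) : ∑ θ ∈ atoms G, G.weights θ = 1 := G.total

lemma weights_pos {θ : EuclideanSpace ℝ (Fin q)} (h : θ ∈ atoms G) : 0 < G.weights θ :=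
  lt_of_le_of_ne (StdSimplex.weights_nonneg θ) (Ne.symm (Finsupp.mem_support_iff.1 h))

lemma IsCoupling.transportCost_nonneg {c} (hc : IsCoupling G H c) : 0 ≤ transportCost r G H c :=
  Finset.sum_nonneg fun θ hθ => Finset.sum_nonneg fun η hη =>
    mul_nonneg (hc.nonneg θ hθ η hη) (by positivity)

lemma isCoupling_prod (G H : DiscreteProb q) :
    IsCoupling G H fun θ η => G.weights θ * H.weights η where
  nonneg θ _ η _ := mul_nonneg (StdSimplex.weights_nonneg θ) (StdSimplex.weights_nonneg η)
  marginal_left θ _ := by rw [← Finset.mul_sum, sum_weights, mul_one]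
  marginal_right η _ := by rw [← Finset.sum_mul, sum_weights, one_mul]

lemma costs_bddBelow (r : ℕ) (G H : DiscreteProb q) :
    BddBelow {x : ℝ | ∃ c, IsCoupling G H c ∧ x = transportCost r G H c} :=
  ⟨0, by rintro x ⟨c, hc, rfl⟩; exact hc.transportCost_nonneg⟩

lemma wasserstein_pow (hr : r ≠ 0) : wasserstein r G H ^ r =
    sInf {x : ℝ | ∃ c, IsCoupling G H c ∧ x = transportCost r G H c} := by
  rw [wasserstein, one_div, Real.rpow_inv_natCast_pow _ hr]
  exact Real.sInf_nonneg (by rintro x ⟨c, hc, rfl⟩; exact hc.transportCost_nonneg)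

lemma wasserstein_nonneg : 0 ≤ wasserstein r G H :=
  Real.rpow_nonneg
    (Real.sInf_nonneg (by rintro x ⟨c, hc, rfl⟩; exact hc.transportCost_nonneg)) _

lemma le_wasserstein_pow (hr : r ≠ 0) {b : ℝ}
    (h : ∀ c, IsCoupling G H c → b ≤ transportCost r G H c) : b ≤ wasserstein r G H ^ r := by
  rw [wasserstein_pow hr]
  exact le_csInf ⟨_, _, isCoupling_prod G H, rfl⟩ (by rintro x ⟨c, hc, rfl⟩; exact h c hc)

lemma wasserstein_pow_le_of_labels {ι κ : Type*} [Fintype ι] [Fintype κ] (hr : r ≠ 0)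
    {x : ι → EuclideanSpace ℝ (Fin q)} {y : κ → EuclideanSpace ℝ (Fin q)}
    (hx : Function.Injective x) (hy : Function.Injective y)
    (hG : ∀ θ, θ ∈ atoms G ↔ ∃ i, x i = θ) (hH : ∀ θ, θ ∈ atoms H ↔ ∃ i, y i = θ)
    (c : ι → κ → ℝ) (hc : ∀ i j, 0 ≤ c i j) (hcx : ∀ i, ∑ j, c i j = G.weights (x i))
    (hcy : ∀ j, ∑ i, c i j = H.weights (y j)) :
    wasserstein r G H ^ r ≤ ∑ i, ∑ j, c i j * ‖x i - y j‖ ^ r := by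
  classical
  have eG : atoms G = Finset.univ.image x := by ext θ; simp [hG]
  have eH : atoms H = Finset.univ.image y := by ext θ; simp [hH]
  set c' : EuclideanSpace ℝ (Fin q) → EuclideanSpace ℝ (Fin q) → ℝ :=
    fun θ η => ∑ i, ∑ j, if x i = θ ∧ y j = η then c i j else 0 with hc'
  have hval : ∀ i j, c' (x i) (y j) = c i j := by
    intro i j
    simp only [hc', hx.eq_iff, hy.eq_iff]
    rw [Finset.sum_eq_single i (fun k _ hk => by simp [hk]) (by simp),
      Finset.sum_eq_single j (fun l _ hl => by simp [hl]) (by simp)]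
    simp
  have hcoup : IsCoupling G H c' := by
    refine ⟨?_, ?_, ?_⟩
    · intro θ hθ η hη
      obtain ⟨i, rfl⟩ := (hG θ).1 hθ
      obtain ⟨j, rfl⟩ := (hH η).1 hη
      rw [hval]; exact hc i j
    · intro θ hθ
      obtain ⟨i, rfl⟩ := (hG θ).1 hθ
      rw [eH, Finset.sum_image hy.injOn, ← hcx]
      exact Finset.sum_congr rfl fun j _ => hval i j
    · intro η hη
      obtain ⟨j, rfl⟩ := (hH η).1 hη
      rw [eG, Finset.sum_image hx.injOn, ← hcy]
      exact Finset.sum_congr rfl fun i _ => hval i j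
  rw [wasserstein_pow hr]
  refine csInf_le (costs_bddBelow r G H) ⟨c', hcoup, ?_⟩
  rw [transportCost, eG, Finset.sum_image hx.injOn]
  refine Finset.sum_congr rfl fun i _ => ?_
  rw [eH, Finset.sum_image hy.injOn]
  exact Finset.sum_congr rfl fun j _ => by rw [hval]

lemma exists_weights_lt (h : G ≠ H) : ∃ θ, H.weights θ < G.weights θ := by
  classical
  by_contra! hle
  apply h
  have hs : ∀ F : DiscreteProb q, atoms F ⊆ atoms G ∪ atoms H →
      ∑ θ ∈ atoms G ∪ atoms H, F.weights θ = 1 := fun F hF => by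
    rw [← sum_weights F]
    exact (Finset.sum_subset hF fun θ _ hθ => Finsupp.notMem_support_iff.1 hθ).symm
  have heq := (Finset.sum_eq_sum_iff_of_le fun θ _ => hle θ).1
    ((hs G Finset.subset_union_left).trans (hs H Finset.subset_union_right).symm)
  refine StdSimplex.ext (Finsupp.ext fun θ => ?_)
  by_cases hθ : θ ∈ atoms G ∪ atoms H
  · exact heq θ hθ
  · simp only [Finset.mem_union, not_or, atoms, Finsupp.notMem_support_iff] at hθ
    rw [hθ.1, hθ.2]

/-- At an atom θ where G exceeds H, the surplus has to travel at least the distance from θ to the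
other atoms of H. -/
lemma wasserstein_pos (hr : r ≠ 0) (h : G ≠ H) : 0 < wasserstein r G H := by
  classical
  obtain ⟨θ, hθ⟩ := exists_weights_lt h
  have hθG : θ ∈ atoms G :=
    Finsupp.mem_support_iff.2 ((StdSimplex.weights_nonneg θ).trans_lt hθ).ne'
  obtain ⟨δ, hδ, hδH⟩ : ∃ δ > 0, ∀ η ∈ (atoms H).erase θ, δ ≤ ‖θ - η‖ := by
    rcases ((atoms H).erase θ).eq_empty_or_nonempty with he | hne
    · exact ⟨1, one_pos, by simp [he]⟩
    · obtain ⟨η, hη, hmin⟩ := Finset.exists_min_image _ (fun η => ‖θ - η‖) hne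
      exact ⟨‖θ - η‖, norm_pos_iff.2 (sub_ne_zero.2 (Finset.ne_of_mem_erase hη).symm), hmin⟩
  have hb : (G.weights θ - H.weights θ) * δ ^ r ≤ wasserstein r G H ^ r := by
    refine le_wasserstein_pow hr fun c hc => ?_
    have h1 : ∑ η ∈ atoms H, c θ η * ‖θ - η‖ ^ r ≤ transportCost r G H c :=
      Finset.single_le_sum (f := fun θ => ∑ η ∈ atoms H, c θ η * ‖θ - η‖ ^ r)
        (fun θ hθ => Finset.sum_nonneg fun η hη =>
          mul_nonneg (hc.nonneg θ hθ η hη) (by positivity)) hθG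
    have h2 : G.weights θ - H.weights θ ≤ ∑ η ∈ (atoms H).erase θ, c θ η := by
      have hl := hc.marginal_left θ hθG
      by_cases hθH : θ ∈ atoms H
      · have hle : c θ θ ≤ H.weights θ := by
          rw [← hc.marginal_right θ hθH]
          exact Finset.single_le_sum (f := fun η => c η θ)
            (fun η hη => hc.nonneg η hη θ hθH) hθG
        rw [← Finset.add_sum_erase _ _ hθH] at hl
        linarith
      · rw [Finset.erase_eq_of_notMem hθH, hl]
        linarith [StdSimplex.weights_nonneg (w := H) θ]
    have h3 : ∑ η ∈ (atoms H).erase θ, c θ η * δ ^ r ≤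
        ∑ η ∈ atoms H, c θ η * ‖θ - η‖ ^ r :=
      (Finset.sum_le_sum fun η hη => mul_le_mul_of_nonneg_left
        (pow_le_pow_left₀ hδ.le (hδH η hη) r)
        (hc.nonneg θ hθG η (Finset.mem_of_mem_erase hη))).trans
      (Finset.sum_le_sum_of_subset_of_nonneg (Finset.erase_subset _ _) fun η hη _ =>
        mul_nonneg (hc.nonneg θ hθG η hη) (by positivity))
    rw [← Finset.sum_mul] at h3
    exact (mul_le_mul_of_nonneg_right h2 (by positivity)).trans (h3.trans h1)
  have hpos : 0 < wasserstein r G H ^ r :=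
    (mul_pos (sub_pos.2 hθ) (by positivity)).trans_le hb
  exact lt_of_le_of_ne wasserstein_nonneg fun h0 => by
    rw [← h0, zero_pow hr] at hpos
    exact lt_irrefl _ hpos

/-- All the mass of H at θ has to come from atoms of G at distance at least ε. -/
lemma le_wasserstein_one {θ : EuclideanSpace ℝ (Fin q)} (hθ : θ ∈ atoms H) {ε : ℝ}
    (h : ∀ η ∈ atoms G, ε ≤ ‖η - θ‖) : ε * H.weights θ ≤ wasserstein 1 G H := by
  rw [← pow_one (wasserstein 1 G H)]
  refine le_wasserstein_pow one_ne_zero fun c hc => ?_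
  rw [← hc.marginal_right θ hθ, Finset.mul_sum]
  refine Finset.sum_le_sum fun η hη => ?_
  refine le_trans ?_ (Finset.single_le_sum (f := fun θ => c η θ * ‖η - θ‖ ^ 1)
    (fun ξ hξ => mul_nonneg (hc.nonneg η hη ξ hξ) (by positivity)) hθ)
  rw [pow_one, mul_comm]
  exact mul_le_mul_of_nonneg_left (h η hη) (hc.nonneg η hη θ hθ)

end Wasserstein

/-! ### Clusters and the normalized limit functional -/

section Clusters

variable {ι : Type} [Fintype ι]

/-- The labels whose limit point is `θ`. -/
def cluster (ζ : ι → EuclideanSpace ℝ (Fin q)) (θ : EuclideanSpace ℝ (Fin q)) : Finset ι := by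
  classical exact Finset.univ.filter fun i => ζ i = θ

/-- The set of limit points. -/
def centers (ζ : ι → EuclideanSpace ℝ (Fin q)) : Finset (EuclideanSpace ℝ (Fin q)) := by
  classical exact Finset.univ.image ζ

/-- The moments of a cluster of a labelled signed measure. -/
def clusterMoment (ζ : ι → EuclideanSpace ℝ (Fin q)) (w : ι → ℝ)
    (z : ι → EuclideanSpace ℝ (Fin q)) (θ : EuclideanSpace ℝ (Fin q)) (α : Fin q → ℕ) : ℝ :=
  ∑ i ∈ cluster ζ θ, w i * monomial α (z i - θ)

/-- The total size of the moments of all clusters; for a cluster of `m` labels those of order less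
than `m` are taken into account. -/
def momentSize (ζ : ι → EuclideanSpace ℝ (Fin q)) (w : ι → ℝ)
    (z : ι → EuclideanSpace ℝ (Fin q)) : ℝ :=
  ∑ θ ∈ centers ζ, ∑ α ∈ multiIndices q (cluster ζ θ).card, |clusterMoment ζ w z θ α|

lemma mem_cluster {ζ : ι → EuclideanSpace ℝ (Fin q)} {θ : EuclideanSpace ℝ (Fin q)} {i : ι} :
    i ∈ cluster ζ θ ↔ ζ i = θ := by
  simp [cluster]

lemma mem_centers {ζ : ι → EuclideanSpace ℝ (Fin q)} {θ : EuclideanSpace ℝ (Fin q)} :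
    θ ∈ centers ζ ↔ ∃ i, ζ i = θ := by
  simp [centers]

lemma sum_centers_cluster (ζ : ι → EuclideanSpace ℝ (Fin q)) (f : ι → ℝ) :
    ∑ θ ∈ centers ζ, ∑ i ∈ cluster ζ θ, f i = ∑ i, f i := by
  classical
  have h := Finset.sum_fiberwise_of_maps_to (s := Finset.univ) (t := centers ζ) (g := ζ)
    (fun i _ => mem_centers.2 ⟨i, rfl⟩) f
  rw [← h]
  refine Finset.sum_congr rfl fun θ _ => Finset.sum_congr ?_ fun _ _ => rfl
  ext i; simp [mem_cluster]

lemma card_cluster_pos {ζ : ι → EuclideanSpace ℝ (Fin q)} {θ : EuclideanSpace ℝ (Fin q)}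
    (h : θ ∈ centers ζ) : 0 < (cluster ζ θ).card := by
  obtain ⟨i, hi⟩ := mem_centers.1 h
  exact Finset.card_pos.2 ⟨i, mem_cluster.2 hi⟩

lemma abs_clusterMoment_le {ζ : ι → EuclideanSpace ℝ (Fin q)} (w : ι → ℝ)
    (z : ι → EuclideanSpace ℝ (Fin q)) {θ : EuclideanSpace ℝ (Fin q)} (hθ : θ ∈ centers ζ)
    {α : Fin q → ℕ} (hα : α ∈ multiIndices q (cluster ζ θ).card) :
    |clusterMoment ζ w z θ α| ≤ momentSize ζ w z :=
  (Finset.single_le_sum (f := fun α => |clusterMoment ζ w z θ α|) (fun _ _ => abs_nonneg _)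
    hα).trans (Finset.single_le_sum
      (f := fun θ => ∑ α ∈ multiIndices q (cluster ζ θ).card, |clusterMoment ζ w z θ α|)
      (fun _ _ => Finset.sum_nonneg fun _ _ => abs_nonneg _) hθ)

/-- The mass of a part of a clustered signed measure at distance at least `ρ` from the rest is
controlled by the moments of the clusters. -/
theorem exists_gap_bound_momentSize (ζ : ι → EuclideanSpace ℝ (Fin q)) {r : ℕ}
    (hm : ∀ θ, (cluster ζ θ).card ≤ r + 1) : ∃ C : ℝ, 0 ≤ C ∧
      ∀ (w : ι → ℝ) (z : ι → EuclideanSpace ℝ (Fin q)), (∀ i, z i ∈ Metric.ball (ζ i) 1) →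
      ∀ (A : Finset ι) (ρ : ℝ), 0 < ρ → ρ ≤ 1 → (∀ i ∈ A, ∀ j, j ∉ A → ρ ≤ ‖z i - z j‖) →
        |∑ i ∈ A, w i| * ρ ^ r ≤ C * momentSize ζ w z := by
  classical
  choose C hC0 hC using fun n => exists_gap_bound q n
  refine ⟨∑ θ ∈ centers ζ, C ((cluster ζ θ).card - 1), Finset.sum_nonneg fun _ _ => hC0 _, ?_⟩
  intro w z hz A ρ hρ hρ1 hgap
  have e : ∑ i ∈ A, w i = ∑ θ ∈ centers ζ, ∑ i ∈ cluster ζ θ ∩ A, w i := by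
    rw [← Finset.sum_fiberwise_of_maps_to (s := A) (t := centers ζ) (g := ζ)
      (fun i _ => mem_centers.2 ⟨i, rfl⟩) w]
    refine Finset.sum_congr rfl fun θ _ => Finset.sum_congr ?_ fun _ _ => rfl
    ext i; simp [mem_cluster, and_comm]
  rw [e, Finset.sum_mul]
  refine (mul_le_mul_of_nonneg_right (Finset.abs_sum_le_sum_abs _ _) (by positivity)).trans ?_
  rw [Finset.sum_mul]
  refine Finset.sum_le_sum fun θ hθ => ?_
  have hpos := card_cluster_pos hθ
  have hm1 : (cluster ζ θ).card - 1 + 1 = (cluster ζ θ).card := by omega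
  -- Inside its cluster, the part of A is still ρ-separated from the remaining labels. A cluster of
  -- m labels gives the exponent m - 1 ≤ r, and ρ ≤ 1 allows it to be raised to r.
  have h := hC ((cluster ζ θ).card - 1) (cluster ζ θ) (cluster ζ θ ∩ A) w z θ (momentSize ζ w z) ρ
    hm1.ge Finset.inter_subset_left hρ hρ1
    (fun i hi => by have := hz i; rwa [mem_cluster.1 hi] at this)
    (by rw [hm1]; exact fun α hα => abs_clusterMoment_le w z hθ hα)
    (fun i hi j hj hjt => hgap i (Finset.mem_inter.1 hi).2 j
      fun hjA => hjt (Finset.mem_inter.2 ⟨hj, hjA⟩))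
  refine le_trans (mul_le_mul_of_nonneg_left ?_ (abs_nonneg _)) h
  have := hm θ
  exact pow_le_pow_of_le_one hρ.le hρ1 (by omega)

variable {T : Type*} {l : Ultrafilter T} {z : T → ι → EuclideanSpace ℝ (Fin q)} {w : T → ι → ℝ}
  {ζ : ι → EuclideanSpace ℝ (Fin q)}

/-- The normalized moments lie in [-1, 1], hence converge along the ultrafilter; their absolute
values add up to 1, so the limits cannot all vanish. -/
lemma exists_tendsto_clusterMoment (hS : ∀ᶠ t in l, 0 < momentSize ζ (w t) (z t)) :
    ∃ a : EuclideanSpace ℝ (Fin q) → (Fin q → ℕ) → ℝ,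
      (∃ θ ∈ centers ζ, ∃ α ∈ multiIndices q (cluster ζ θ).card, a θ α ≠ 0) ∧
      ∀ θ ∈ centers ζ, ∀ α ∈ multiIndices q (cluster ζ θ).card,
        Tendsto (fun t => clusterMoment ζ (w t) (z t) θ α / momentSize ζ (w t) (z t)) l
          (𝓝 (a θ α)) := by
  have hex : ∀ θ α, ∃ b : ℝ, θ ∈ centers ζ → α ∈ multiIndices q (cluster ζ θ).card →
      Tendsto (fun t => clusterMoment ζ (w t) (z t) θ α / momentSize ζ (w t) (z t)) l (𝓝 b) := by
    intro θ α
    by_cases h : θ ∈ centers ζ ∧ α ∈ multiIndices q (cluster ζ θ).card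
    · have hb : ∀ᶠ t in l, clusterMoment ζ (w t) (z t) θ α / momentSize ζ (w t) (z t) ∈
          Set.Icc (-1 : ℝ) 1 := by
        filter_upwards [hS] with t ht
        rw [Set.mem_Icc, ← abs_le, abs_div, abs_of_pos ht, div_le_one ht]
        exact abs_clusterMoment_le _ _ h.1 h.2
      obtain ⟨b, -, hb⟩ := isCompact_Icc.ultrafilter_le_nhds
        (l.map fun t => clusterMoment ζ (w t) (z t) θ α / momentSize ζ (w t) (z t))
        (le_principal_iff.2 hb)
      exact ⟨b, fun _ _ => hb⟩
    · exact ⟨0, fun h1 h2 => absurd ⟨h1, h2⟩ h⟩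
  choose a ha using hex
  refine ⟨a, ?_, fun θ hθ α hα => ha θ α hθ hα⟩
  by_contra! h0
  have hlim : Tendsto (fun t => ∑ θ ∈ centers ζ, ∑ α ∈ multiIndices q (cluster ζ θ).card,
      |clusterMoment ζ (w t) (z t) θ α / momentSize ζ (w t) (z t)|) l (𝓝
      (∑ θ ∈ centers ζ, ∑ α ∈ multiIndices q (cluster ζ θ).card, |a θ α|)) :=
    tendsto_finsetSum _ fun θ hθ => tendsto_finsetSum _ fun α hα => (ha θ α hθ hα).abs
  have hz0 : ∑ θ ∈ centers ζ, ∑ α ∈ multiIndices q (cluster ζ θ).card, |a θ α| = 0 :=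
    Finset.sum_eq_zero fun θ hθ => Finset.sum_eq_zero fun α hα => by rw [h0 θ hθ α hα, abs_zero]
  rw [hz0] at hlim
  have h1 : Tendsto (fun _ : T => (1 : ℝ)) l (𝓝 0) := by
    refine hlim.congr' ?_
    filter_upwards [hS] with t ht
    simp only [abs_div, abs_of_pos ht, ← Finset.sum_div]
    exact div_self ht.ne'
  exact one_ne_zero (tendsto_nhds_unique tendsto_const_nhds h1)

/-- The limit of a normalized clustered signed measure, as a functional on functions which are
sufficiently often continuously differentiable near the limit points. -/
theorem tendsto_sum_div_momentSize (hz : ∀ i, Tendsto (fun t => z t i) l (𝓝 (ζ i)))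
    (hS : ∀ᶠ t in l, 0 < momentSize ζ (w t) (z t))
    {a : EuclideanSpace ℝ (Fin q) → (Fin q → ℕ) → ℝ}
    (ha : ∀ θ ∈ centers ζ, ∀ α ∈ multiIndices q (cluster ζ θ).card,
        Tendsto (fun t => clusterMoment ζ (w t) (z t) θ α / momentSize ζ (w t) (z t)) l
          (𝓝 (a θ α)))
    {V : Set (EuclideanSpace ℝ (Fin q))} (hV : IsOpen V) (hζ : ∀ i, ζ i ∈ V)
    {f : EuclideanSpace ℝ (Fin q) → ℝ}
    (hf : ∀ θ ∈ centers ζ, ContDiffOn ℝ ((cluster ζ θ).card - 1 : ℕ) f V) :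
    Tendsto (fun t => (∑ i, w t i * f (z t i)) / momentSize ζ (w t) (z t)) l
      (𝓝 (∑ θ ∈ centers ζ, ∑ α ∈ multiIndices q (cluster ζ θ).card,
        a θ α / (∏ i, ((α i).factorial : ℝ)) * partialDeriv α f θ)) := by
  have e : ∀ t, (∑ i, w t i * f (z t i)) / momentSize ζ (w t) (z t) =
      ∑ θ ∈ centers ζ, (∑ i ∈ cluster ζ θ, w t i * f (z t i)) / momentSize ζ (w t) (z t) :=
    fun t => by rw [← Finset.sum_div, sum_centers_cluster]
  simp only [e]
  refine tendsto_finsetSum _ fun θ hθ => ?_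
  set n := (cluster ζ θ).card - 1 with hn
  have hn1 : n + 1 = (cluster ζ θ).card := by have := card_cluster_pos hθ; omega
  have hθV : θ ∈ V := by
    obtain ⟨i, rfl⟩ := mem_centers.1 hθ
    exact hζ i
  set P := taylorPoly n (fun α => partialDeriv α f θ) θ with hP
  -- The Taylor polynomial yields exactly the cluster moments of order less than the number of
  -- labels; the remainder is then tested against the same moments.
  have hsplit : ∀ t, (∑ i ∈ cluster ζ θ, w t i * f (z t i)) / momentSize ζ (w t) (z t) =
      ∑ α ∈ multiIndices q (cluster ζ θ).card, partialDeriv α f θ / (∏ i, ((α i).factorial : ℝ)) *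
        (clusterMoment ζ (w t) (z t) θ α / momentSize ζ (w t) (z t)) +
      (∑ i ∈ cluster ζ θ, w t i * (f (z t i) - P (z t i))) / momentSize ζ (w t) (z t) := by
    intro t
    have h1 : ∑ i ∈ cluster ζ θ, w t i * P (z t i) =
        ∑ α ∈ multiIndices q (cluster ζ θ).card,
          partialDeriv α f θ / (∏ i, ((α i).factorial : ℝ)) * clusterMoment ζ (w t) (z t) θ α := by
      simp only [hP, taylorPoly, clusterMoment, Finset.mul_sum, hn1]
      rw [Finset.sum_comm]
      exact Finset.sum_congr rfl fun α _ => Finset.sum_congr rfl fun i _ => by ring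
    simp only [mul_sub, Finset.sum_sub_distrib, sub_div, h1, Finset.sum_div, mul_div_assoc]
    ring
  simp only [hsplit]
  have hmain : Tendsto (fun t => ∑ α ∈ multiIndices q (cluster ζ θ).card,
      partialDeriv α f θ / (∏ i, ((α i).factorial : ℝ)) *
        (clusterMoment ζ (w t) (z t) θ α / momentSize ζ (w t) (z t))) l
      (𝓝 (∑ α ∈ multiIndices q (cluster ζ θ).card,
        a θ α / (∏ i, ((α i).factorial : ℝ)) * partialDeriv α f θ)) := by
    refine tendsto_finsetSum _ fun α hα => ?_
    have := (ha θ hθ α hα).const_mul (partialDeriv α f θ / (∏ i, ((α i).factorial : ℝ)))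
    convert this using 2
    ring
  have hrem : Tendsto (fun t => (∑ i ∈ cluster ζ θ, w t i * (f (z t i) - P (z t i))) /
      momentSize ζ (w t) (z t)) l (𝓝 0) := by
    rw [Metric.tendsto_nhds]
    intro ε hε
    set M : ℝ := (1 + 2 * q) ^ n with hM
    have hM0 : 0 < M := by positivity
    obtain ⟨δ, hδ, hδ1, hb⟩ := exists_derivBound_taylor hV hθV (hf θ hθ)
      (ε := ε / (2 * M)) (by positivity)
    have hnear : ∀ᶠ t in l, ∀ i, z t i ∈ Metric.ball (ζ i) δ :=
      eventually_all.2 fun i => (hz i).eventually (Metric.ball_mem_nhds _ hδ)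
    filter_upwards [hS, hnear] with t ht hnear
    have h := abs_sum_le_of_moments Metric.isOpen_ball (convex_ball θ δ)
      (Metric.ball_subset_ball hδ1) hb (by positivity) (cluster ζ θ) hn1.ge (w t) (z t)
      (fun i hi => by have := hnear i; rwa [mem_cluster.1 hi] at this)
      (N := momentSize ζ (w t) (z t))
      (by rw [hn1]; exact fun α hα => abs_clusterMoment_le _ _ hθ hα)
    rw [Real.dist_eq, sub_zero, abs_div, abs_of_pos ht, div_lt_iff₀ ht]
    refine h.trans_lt ?_
    have : M * (ε / (2 * M) * momentSize ζ (w t) (z t)) = ε / 2 * momentSize ζ (w t) (z t) := by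
      field_simp
    rw [this]
    exact mul_lt_mul_of_pos_right (by linarith) ht
  simpa using hmain.add hrem

end Clusters

/-! ### Labelled atoms and the bound of the Wasserstein distance by moments -/

section Labels

variable {G H : DiscreteProb q}

/-- `x` enumerates the atoms of `G`. -/
structure IsLabelling {ι : Type*} (G : DiscreteProb q) (x : ι → EuclideanSpace ℝ (Fin q)) :
    Prop where
  injective : Function.Injective x
  mem_atoms : ∀ θ, θ ∈ atoms G ↔ ∃ i, x i = θ

lemma exists_isLabelling {g : ℕ} (h : (atoms G).card = g) :
    ∃ x : Fin g → EuclideanSpace ℝ (Fin q), IsLabelling G x := by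
  subst h
  refine ⟨fun i => (atoms G).equivFin.symm i, fun i j hij => ?_, fun θ => ⟨fun hθ => ?_, ?_⟩⟩
  · exact (atoms G).equivFin.symm.injective (Subtype.ext hij)
  · exact ⟨(atoms G).equivFin ⟨θ, hθ⟩, by simp⟩
  · rintro ⟨i, rfl⟩
    exact ((atoms G).equivFin.symm i).2

lemma IsLabelling.sum_atoms {ι : Type*} [Fintype ι] {x : ι → EuclideanSpace ℝ (Fin q)}
    (hx : IsLabelling G x) (f : EuclideanSpace ℝ (Fin q) → ℝ) :
    ∑ θ ∈ atoms G, f θ = ∑ i, f (x i) := by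
  classical
  have : atoms G = Finset.univ.image x := by ext θ; simp [hx.mem_atoms]
  rw [this, Finset.sum_image hx.injective.injOn]

lemma IsLabelling.weights_pos {ι : Type*} {x : ι → EuclideanSpace ℝ (Fin q)}
    (hx : IsLabelling G x) (i : ι) : 0 < G.weights (x i) :=
  MixingMeasure.weights_pos ((hx.mem_atoms _).2 ⟨i, rfl⟩)

/-- The weights of the signed measure `G - H`. -/
def signedWeights {ι κ : Type*} (G H : DiscreteProb q) (x : ι → EuclideanSpace ℝ (Fin q))
    (y : κ → EuclideanSpace ℝ (Fin q)) : ι ⊕ κ → ℝ :=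
  Sum.elim (fun i => G.weights (x i)) fun j => -H.weights (y j)

lemma sum_signedWeights_mul {ι κ : Type*} [Fintype ι] [Fintype κ]
    {x : ι → EuclideanSpace ℝ (Fin q)} {y : κ → EuclideanSpace ℝ (Fin q)}
    (hx : IsLabelling G x) (hy : IsLabelling H y) (f : EuclideanSpace ℝ (Fin q) → ℝ) :
    ∑ i, signedWeights G H x y i * f (Sum.elim x y i) = integral G f - integral H f := by
  rw [Fintype.sum_sum_type, integral, integral, hx.sum_atoms, hy.sum_atoms]
  simp [signedWeights, sub_eq_add_neg]

lemma sum_signedWeights {ι κ : Type*} [Fintype ι] [Fintype κ]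
    {x : ι → EuclideanSpace ℝ (Fin q)} {y : κ → EuclideanSpace ℝ (Fin q)}
    (hx : IsLabelling G x) (hy : IsLabelling H y) : ∑ i, signedWeights G H x y i = 0 := by
  have h := sum_signedWeights_mul hx hy fun _ => 1
  simpa [integral, sum_weights] using h

/-- The Wasserstein distance is controlled by the moments of the clusters of `G - H`. -/
theorem exists_wasserstein_pow_le_momentSize {ι κ : Type} [Fintype ι] [Fintype κ]
    (ζ : ι ⊕ κ → EuclideanSpace ℝ (Fin q)) {r : ℕ} (hr : r ≠ 0)
    (hm : ∀ θ, (cluster ζ θ).card ≤ r + 1) {D : ℝ} (hD : 1 ≤ D) :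
    ∃ C : ℝ, 0 ≤ C ∧ ∀ (G H : DiscreteProb q) (x : ι → EuclideanSpace ℝ (Fin q))
      (y : κ → EuclideanSpace ℝ (Fin q)), IsLabelling G x → IsLabelling H y →
      (∀ i, Sum.elim x y i ∈ Metric.ball (ζ i) 1) →
      (∀ i j, ‖Sum.elim x y i - Sum.elim x y j‖ ≤ D) →
      wasserstein r G H ^ r ≤ C * momentSize ζ (signedWeights G H x y) (Sum.elim x y) := by
  classical
  obtain ⟨C, hC0, hC⟩ := exists_gap_bound_momentSize ζ hm
  refine ⟨(4 * 4 ^ r) ^ (Fintype.card (ι ⊕ κ)) * (D ^ r * C), by positivity, ?_⟩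
  intro G H x y hx hy hball hdiam
  set w := signedWeights G H x y with hw
  set z := Sum.elim x y with hz
  -- A common atom of G and H keeps two labels at the same point, with weights of opposite signs. So
  -- no weight vanishes, and gaps are tested against all labels.
  have hw0 : ∀ i, w i ≠ 0 := by
    rintro (i | j)
    · exact (hx.weights_pos i).ne'
    · exact neg_ne_zero.2 (hy.weights_pos j).ne'
  obtain ⟨c, hc0, hc1, hc2, hc3⟩ := exists_transport hr hD hdiam (Fintype.card (ι ⊕ κ)) w
    (C * momentSize ζ w z) (Finset.card_le_univ _) (sum_signedWeights hx hy)
    (fun A ρ hρ hρ1 hgap => hC w z hball A ρ hρ hρ1 fun i hi j hj =>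
      hgap i hi j hj (hw0 i) (hw0 j))
  -- The marginals of c force all its mass to run from labels of G to labels of H, so that block is
  -- a coupling.
  have hll : ∀ i i', c i (Sum.inl i') = 0 := by
    intro i i'
    have h := hc2 (Sum.inl i')
    have h0 : max (-w (Sum.inl i')) 0 = 0 := max_eq_right (neg_nonpos.2 (hx.weights_pos i').le)
    rw [h0] at h
    exact (Finset.sum_eq_zero_iff_of_nonneg fun k _ => hc0 k _).1 h i (Finset.mem_univ i)
  have hrr : ∀ j i, c (Sum.inr j) i = 0 := by
    intro j i
    have h := hc1 (Sum.inr j)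
    have h0 : max (w (Sum.inr j)) 0 = 0 := max_eq_right (neg_nonpos.2 (hy.weights_pos j).le)
    rw [h0] at h
    exact (Finset.sum_eq_zero_iff_of_nonneg fun k _ => hc0 _ k).1 h i (Finset.mem_univ i)
  have key := wasserstein_pow_le_of_labels hr hx.injective hy.injective hx.mem_atoms hy.mem_atoms
    (fun i j => c (Sum.inl i) (Sum.inr j)) (fun i j => hc0 _ _)
    (fun i => by
      have h := hc1 (Sum.inl i)
      rw [Fintype.sum_sum_type] at h
      simp only [hll, Finset.sum_const_zero, zero_add] at h
      rw [h]
      exact max_eq_left (hx.weights_pos i).le)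
    (fun j => by
      have h := hc2 (Sum.inr j)
      rw [Fintype.sum_sum_type] at h
      simp only [hrr, Finset.sum_const_zero, add_zero] at h
      rw [h]
      change max (- -H.weights (y j)) 0 = _
      rw [neg_neg, max_eq_left (hy.weights_pos j).le])
  refine key.trans ?_
  have e : ∑ i, ∑ j, c i j * ‖z i - z j‖ ^ r =
      ∑ i, ∑ j, c (Sum.inl i) (Sum.inr j) * ‖x i - y j‖ ^ r := by
    simp [Fintype.sum_sum_type, hll, hrr, hz]
  rw [← e]
  exact hc3.trans (le_of_eq (by ring))

end Labels

/-! ### Counting labels and limit points -/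

section Counting

variable {g : ℕ} {ξ : Fin g → EuclideanSpace ℝ (Fin q)} {S : Finset (EuclideanSpace ℝ (Fin q))}

lemma card_le_card_filter_mem (hS : ∀ θ ∈ S, ∃ i, ξ i = θ) :
    S.card ≤ (Finset.univ.filter fun i => ξ i ∈ S).card := by
  classical
  refine (Finset.card_le_card (t := (Finset.univ.filter fun i => ξ i ∈ S).image ξ) ?_).trans
    Finset.card_image_le
  intro θ hθ
  obtain ⟨i, rfl⟩ := hS θ hθ
  exact Finset.mem_image.2 ⟨i, by simpa using hθ, rfl⟩

-- Each point of S other than θ uses up at least one label.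
open Classical in
lemma card_filter_eq_add_card_le (hS : ∀ θ ∈ S, ∃ i, ξ i = θ) (θ : EuclideanSpace ℝ (Fin q)) :
    (Finset.univ.filter fun i => ξ i = θ).card + S.card ≤ g + 1 := by
  have h1 := card_le_card_filter_mem (S := S.erase θ) (ξ := ξ)
    fun η hη => hS η (Finset.mem_of_mem_erase hη)
  have h2 : (Finset.univ.filter fun i => ξ i ∈ S.erase θ).card ≤
      (Finset.univ.filter fun i => ¬ ξ i = θ).card := by
    refine Finset.card_le_card fun i hi => ?_
    simp only [Finset.mem_filter, Finset.mem_univ, true_and, Finset.mem_erase] at hi ⊢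
    exact hi.1
  have h3 := Finset.card_filter_add_card_filter_not (s := (Finset.univ : Finset (Fin g)))
    (fun i => ξ i = θ)
  rw [Finset.card_univ, Fintype.card_fin] at h3
  have h4 := Finset.pred_card_le_card_erase (s := S) (a := θ)
  omega

variable {h : ℕ} {η : Fin h → EuclideanSpace ℝ (Fin q)}

lemma card_cluster_add_le (hS : ∀ θ ∈ S, ∃ i, ξ i = θ) (hS' : ∀ θ ∈ S, ∃ i, η i = θ)
    (θ : EuclideanSpace ℝ (Fin q)) :
    (cluster (Sum.elim ξ η) θ).card + 2 * S.card ≤ g + h + 2 := by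
  classical
  have h1 := card_filter_eq_add_card_le hS θ
  have h2 := card_filter_eq_add_card_le hS' θ
  have e : (cluster (Sum.elim ξ η) θ).card = (Finset.univ.filter fun i => ξ i = θ).card +
      (Finset.univ.filter fun i => η i = θ).card := by
    have : cluster (Sum.elim ξ η) θ = Finset.univ.filter fun i => Sum.elim ξ η i = θ := by
      ext i; simp [mem_cluster]
    rw [this]
    simp only [Finset.card_filter, Fintype.sum_sum_type, Sum.elim_inl, Sum.elim_inr]
    congr!
  omega

/-- A point of S accounts for at least two labels, one from each family, but for only one limit
point. -/
lemma card_centers_add_le (hS : ∀ θ ∈ S, ∃ i, ξ i = θ) (hS' : ∀ θ ∈ S, ∃ i, η i = θ) :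
    (centers (Sum.elim ξ η)).card + S.card ≤ g + h := by
  classical
  have h1 := card_le_card_filter_mem hS
  have h2 := card_le_card_filter_mem hS'
  have h3 := Finset.card_filter_add_card_filter_not (s := (Finset.univ : Finset (Fin g ⊕ Fin h)))
    (fun i => Sum.elim ξ η i ∈ S)
  have h4 : (Finset.univ.filter fun i => Sum.elim ξ η i ∈ S).card =
      (Finset.univ.filter fun i => ξ i ∈ S).card + (Finset.univ.filter fun i => η i ∈ S).card := by
    simp only [Finset.card_filter, Fintype.sum_sum_type, Sum.elim_inl, Sum.elim_inr]
    congr!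
  have h5 : centers (Sum.elim ξ η) ⊆
      S ∪ (Finset.univ.filter fun i => ¬ Sum.elim ξ η i ∈ S).image (Sum.elim ξ η) := by
    intro θ hθ
    obtain ⟨i, rfl⟩ := mem_centers.1 hθ
    by_cases hi : Sum.elim ξ η i ∈ S
    · exact Finset.mem_union_left _ hi
    · exact Finset.mem_union_right _ (Finset.mem_image.2 ⟨i, by simpa using hi, rfl⟩)
  have h6 := (Finset.card_le_card h5).trans (Finset.card_union_le _ _)
  have h7 := Finset.card_image_le (s := Finset.univ.filter fun i => ¬ Sum.elim ξ η i ∈ S)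
    (f := Sum.elim ξ η)
  simp only [Finset.card_univ, Fintype.card_sum, Fintype.card_fin] at h3
  omega

end Counting

/-! ### Compactness argument and conclusion -/

/-- Every atom of the limit in `W₁` is a limit of atoms. -/
lemma exists_limit_eq_of_wasserstein_one {T : Type*} {l : Filter T} [l.NeBot]
    {G : T → DiscreteProb q} {G₀ : DiscreteProb q} {g : ℕ}
    {x : T → Fin g → EuclideanSpace ℝ (Fin q)} {ξ : Fin g → EuclideanSpace ℝ (Fin q)}
    (hG : Tendsto (fun t => wasserstein 1 (G t) G₀) l (𝓝 0))
    (hx : ∀ᶠ t in l, IsLabelling (G t) (x t))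
    (hξ : ∀ i, Tendsto (fun t => x t i) l (𝓝 (ξ i))) :
    ∀ θ ∈ atoms G₀, ∃ i, ξ i = θ := by
  intro θ hθ
  by_contra! hne
  obtain ⟨ε, hε, hε0⟩ : ∃ ε, (∀ i, ε ∈ Set.Ioo 0 ‖ξ i - θ‖) ∧ 0 < ε :=
    ((eventually_all.2 fun i => Ioo_mem_nhdsGT (norm_pos_iff.2 (sub_ne_zero.2 (hne i)))).and
      self_mem_nhdsWithin : ∀ᶠ ε in 𝓝[>] (0 : ℝ), _).exists
  have hfar : ∀ᶠ t in l, ∀ i, ε < ‖x t i - θ‖ := eventually_all.2 fun i =>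
    ((hξ i).sub_const θ).norm.eventually_const_lt (hε i).2
  have hle : ∀ᶠ t in l, ε * G₀.weights θ ≤ wasserstein 1 (G t) G₀ := by
    filter_upwards [hx, hfar] with t hxt hft
    refine le_wasserstein_one hθ fun η hη => ?_
    obtain ⟨i, rfl⟩ := (hxt.mem_atoms η).1 hη
    exact (hft i).le
  have := ge_of_tendsto hG hle
  exact absurd this (not_le.2 (mul_pos hε0 (weights_pos hθ)))

/-- If the local inverse bound fails, the quotient tends to `0` along some ultrafilter. -/
lemma exists_ultrafilter_of_not_localInverseBound
    {Φ : Set (EuclideanSpace ℝ (Fin q) → ℝ)} {Θ : Set (EuclideanSpace ℝ (Fin q))} {k : ℕ}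
    {G₀ : DiscreteProb q} (h : ¬ LocalInverseBound Φ Θ k G₀) :
    ∃ l : Ultrafilter (DiscreteProb q × DiscreteProb q), ↑l ≤ pairsTo Θ k G₀ ∧
      Tendsto (fun p : DiscreteProb q × DiscreteProb q => deviation Φ p.1 p.2 /
        ENNReal.ofReal (wasserstein (2 * overfitIndex k G₀ - 1) p.1 p.2 ^
          (2 * overfitIndex k G₀ - 1))) l (𝓝 0) := by
  rw [LocalInverseBound, not_lt] at h
  -- A liminf ≤ 0 in [0, ∞] means that the quotient is frequently below every ε > 0, so 0 is one of
  -- its cluster points.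
  refine mapClusterPt_iff_ultrafilter.1 (mapClusterPt_iff_frequently.2 fun s hs => ?_)
  obtain ⟨ε, hε, hεs⟩ := ENNReal.nhds_zero_basis.mem_iff.1 hs
  exact (frequently_lt_of_liminf_lt (by isBoundedDefault) (h.trans_lt hε)).mono fun p hp => hεs hp

lemma tendsto_wasserstein_of_le_pairsTo {Θ : Set (EuclideanSpace ℝ (Fin q))} {k : ℕ}
    {G₀ : DiscreteProb q} {l : Filter (DiscreteProb q × DiscreteProb q)}
    (hl : l ≤ pairsTo Θ k G₀) :
    Tendsto (fun p => wasserstein 1 p.1 G₀) l (𝓝 0) ∧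
      Tendsto (fun p => wasserstein 1 p.2 G₀) l (𝓝 0) := by
  have h : Tendsto (fun p => (wasserstein 1 p.1 G₀, wasserstein 1 p.2 G₀)) l
      (𝓝 ((0 : ℝ), (0 : ℝ))) := tendsto_iff_comap.2 (hl.trans inf_le_left)
  exact ⟨(continuous_fst.tendsto _).comp h, (continuous_snd.tendsto _).comp h⟩

lemma abs_integral_sub_le {Φ : Set (EuclideanSpace ℝ (Fin q) → ℝ)} {G H : DiscreteProb q} {r : ℕ}
    (hr : r ≠ 0) (hGH : G ≠ H) {ε : ℝ} (hε : 0 ≤ ε)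
    (h : deviation Φ G H / ENNReal.ofReal (wasserstein r G H ^ r) ≤ ENNReal.ofReal ε)
    {φ : EuclideanSpace ℝ (Fin q) → ℝ} (hφ : φ ∈ Φ) :
    |integral G φ - integral H φ| ≤ ε * wasserstein r G H ^ r := by
  have hW : 0 < wasserstein r G H ^ r := pow_pos (wasserstein_pos hr hGH) r
  rw [ENNReal.div_le_iff (by simpa using hW) ENNReal.ofReal_ne_top,
    ← ENNReal.ofReal_mul hε] at h
  have h1 : ENNReal.ofReal |integral G φ - integral H φ| ≤ deviation Φ G H :=
    le_iSup₂_of_le φ hφ le_rfl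
  exact (ENNReal.ofReal_le_ofReal_iff (by positivity)).1 (h1.trans h)

theorem localInverseBound_of_isLinearIndependentDomain
    {Θ : Set (EuclideanSpace ℝ (Fin q))} (hΘ : IsCompact Θ)
    {Φ : Set (EuclideanSpace ℝ (Fin q) → ℝ)} {k k₀ : ℕ} (hk₀ : k₀ ≤ k)
    (hΦ : IsLinearIndependentDomain Φ Θ (2 * (k - k₀ + 1) - 1) k₀ k)
    {G₀ : DiscreteProb q} (hG₀ : G₀ ∈ exactly k₀ Θ) : LocalInverseBound Φ Θ k G₀ := by
  classical
  by_contra hneg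
  obtain ⟨l, hl, hratio⟩ := exists_ultrafilter_of_not_localInverseBound hneg
  obtain ⟨hW1, hW2⟩ := tendsto_wasserstein_of_le_pairsTo hl
  have hpairs : ∀ᶠ p : DiscreteProb q × DiscreteProb q in (l : Filter _),
      p.1 ∈ atMost k Θ ∧ p.2 ∈ atMost k Θ ∧ p.1 ≠ p.2 :=
    le_principal_iff.1 (hl.trans inf_le_right)
  have hover : overfitIndex k G₀ = k - k₀ + 1 := by rw [overfitIndex, hG₀.2]
  rw [hover] at hratio
  set r := 2 * (k - k₀ + 1) - 1 with hr
  have hr0 : r ≠ 0 := by omega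
  -- The number of atoms takes finitely many values, hence is constant along the ultrafilter, and
  -- the labels can be indexed by a fixed type.
  obtain ⟨g, hg⟩ : ∃ g : Fin (k + 1), ∀ᶠ p : DiscreteProb q × DiscreteProb q in l,
      (atoms p.1).card = g :=
    Ultrafilter.eventually_exists_iff.1 (hpairs.mono fun p hp =>
      ⟨⟨_, Nat.lt_succ_of_le hp.1.2⟩, rfl⟩)
  obtain ⟨h, hh⟩ : ∃ h : Fin (k + 1), ∀ᶠ p : DiscreteProb q × DiscreteProb q in l,
      (atoms p.2).card = h :=
    Ultrafilter.eventually_exists_iff.1 (hpairs.mono fun p hp =>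
      ⟨⟨_, Nat.lt_succ_of_le hp.2.1.2⟩, rfl⟩)
  obtain ⟨x, hx⟩ := Eventually.choice (hg.mono fun p hp => exists_isLabelling hp)
  obtain ⟨y, hy⟩ := Eventually.choice (hh.mono fun p hp => exists_isLabelling hp)
  have hxΘ : ∀ᶠ p in (l : Filter _), ∀ i, x p i ∈ Θ := by
    filter_upwards [hpairs, hx] with p hp hxp i
    exact hp.1.1 ((hxp.mem_atoms _).2 ⟨i, rfl⟩)
  have hyΘ : ∀ᶠ p in (l : Filter _), ∀ i, y p i ∈ Θ := by
    filter_upwards [hpairs, hy] with p hp hyp i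
    exact hp.2.1.1 ((hyp.mem_atoms _).2 ⟨i, rfl⟩)
  have hξ : ∀ i, ∃ θ ∈ Θ, Tendsto (fun p => x p i) l (𝓝 θ) := fun i =>
    hΘ.ultrafilter_le_nhds (l.map fun p => x p i) (le_principal_iff.2 (hxΘ.mono fun p hp => hp i))
  have hη : ∀ i, ∃ θ ∈ Θ, Tendsto (fun p => y p i) l (𝓝 θ) := fun i =>
    hΘ.ultrafilter_le_nhds (l.map fun p => y p i) (le_principal_iff.2 (hyΘ.mono fun p hp => hp i))
  choose ξ hξΘ hξ using hξ
  choose η hηΘ hη using hη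
  set ζ := Sum.elim ξ η with hζ
  have hζΘ : ∀ i, ζ i ∈ Θ := by rintro (i | i); exacts [hξΘ i, hηΘ i]
  have hz : ∀ i, Tendsto (fun p => Sum.elim (x p) (y p) i) l (𝓝 (ζ i)) := by
    rintro (i | i); exacts [hξ i, hη i]
  have hcov := exists_limit_eq_of_wasserstein_one hW1 hx hξ
  have hcov' := exists_limit_eq_of_wasserstein_one hW2 hy hη
  have hgk := g.is_le
  have hhk := h.is_le
  -- Here r + 1 = 2(k - k₀ + 1). Atoms of vanishing mass may converge outside the atoms of G₀; those
  -- limits are counted as well.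
  have hm : ∀ θ, (cluster ζ θ).card ≤ r + 1 := fun θ => by
    have := card_cluster_add_le hcov hcov' θ
    rw [hG₀.2, ← hζ] at this
    omega
  have hcard := card_centers_add_le hcov hcov'
  rw [hG₀.2, ← hζ] at hcard
  have hk₀le : k₀ ≤ (centers ζ).card := by
    rw [← hG₀.2]
    refine Finset.card_le_card fun θ hθ => ?_
    obtain ⟨i, hi⟩ := hcov θ hθ
    exact mem_centers.2 ⟨Sum.inl i, hi⟩
  have hsumcard : ∑ θ ∈ centers ζ, (cluster ζ θ).card = g + h := by
    have := sum_centers_cluster ζ fun _ => 1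
    simp only [Finset.sum_const, mul_one, nsmul_eq_mul] at this
    simp only [Finset.card_univ, Fintype.card_sum, Fintype.card_fin] at this
    exact_mod_cast this
  have hcov_card := fun (n : ℕ) (ξ : Fin n → EuclideanSpace ℝ (Fin q))
    (hc : ∀ θ ∈ atoms G₀, ∃ i, ξ i = θ) => (card_le_card_filter_mem hc).trans
      ((Finset.card_le_univ _).trans (Fintype.card_fin n).le)
  have hk₀g := hcov_card _ ξ hcov
  have hk₀h := hcov_card _ η hcov'
  rw [hG₀.2] at hk₀g hk₀h
  obtain ⟨R, hR⟩ := hΘ.isBounded.exists_norm_le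
  obtain ⟨C, hC0, hC⟩ := exists_wasserstein_pow_le_momentSize ζ hr0 hm
    (le_max_left 1 (R + R))
  set S : DiscreteProb q × DiscreteProb q → ℝ := fun p =>
    momentSize ζ (signedWeights p.1 p.2 (x p) (y p)) (Sum.elim (x p) (y p)) with hS
  have hWS : ∀ᶠ p in (l : Filter _), wasserstein r p.1 p.2 ^ r ≤ C * S p := by
    have hball : ∀ᶠ p in (l : Filter _), ∀ i, Sum.elim (x p) (y p) i ∈ Metric.ball (ζ i) 1 :=
      eventually_all.2 fun i => (hz i).eventually (Metric.ball_mem_nhds _ one_pos)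
    filter_upwards [hx, hy, hball, hxΘ, hyΘ] with p hxp hyp hbp hxpΘ hypΘ
    refine hC p.1 p.2 _ _ hxp hyp hbp fun i j => ?_
    have hb : ∀ i, ‖Sum.elim (x p) (y p) i‖ ≤ R := by
      rintro (i | i); exacts [hR _ (hxpΘ i), hR _ (hypΘ i)]
    exact (norm_sub_le _ _).trans ((add_le_add (hb i) (hb j)).trans (le_max_right _ _))
  -- Since G ≠ H the Wasserstein distance is positive, so the transport bound also shows that S may
  -- be divided by.
  have hSpos : ∀ᶠ p in (l : Filter _), 0 < S p := by
    filter_upwards [hWS, hpairs] with p hp hne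
    have h1 : 0 < wasserstein r p.1 p.2 ^ r := pow_pos (wasserstein_pos hr0 hne.2.2) r
    exact pos_of_mul_pos_right (h1.trans_le hp) hC0
  obtain ⟨a, ⟨θ₁, hθ₁, α₁, hα₁, hane⟩, ha⟩ := exists_tendsto_clusterMoment hSpos
  have hint : ∀ f, ∀ᶠ p in (l : Filter _), ∑ i, signedWeights p.1 p.2 (x p) (y p) i *
      f (Sum.elim (x p) (y p) i) = integral p.1 f - integral p.2 f := fun f => by
    filter_upwards [hx, hy] with p hxp hyp
    exact sum_signedWeights_mul hxp hyp f
  have hlimΦ : ∀ φ ∈ Φ, ∑ θ ∈ centers ζ, ∑ α ∈ multiIndices q (cluster ζ θ).card,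
      a θ α / (∏ i, ((α i).factorial : ℝ)) * partialDeriv α φ θ = 0 := by
    intro φ hφ
    obtain ⟨V, hV, hΘV, hφV⟩ := hΦ.contDiff φ hφ
    have h1 := tendsto_sum_div_momentSize hz hSpos ha hV (fun i => hΘV (hζΘ i)) (f := φ)
      (fun θ _ => by
        have h2 : (cluster ζ θ).card - 1 ≤ r := by have := hm θ; omega
        exact hφV.of_le (WithTop.coe_le_coe.2 (Nat.cast_le (α := ℕ∞).2 h2)))
    refine tendsto_nhds_unique h1 ?_
    rw [Metric.tendsto_nhds]
    intro ε hε
    -- The denominator uses C + 1 because C may be 0.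
    have hsmall : ∀ᶠ p : DiscreteProb q × DiscreteProb q in (l : Filter _), deviation Φ p.1 p.2 /
        ENNReal.ofReal (wasserstein r p.1 p.2 ^ r) ≤ ENNReal.ofReal (ε / (2 * (C + 1))) :=
      (hratio.eventually_lt_const (by simp; positivity)).mono fun p hp => hp.le
    filter_upwards [hsmall, hSpos, hWS, hpairs, hint φ] with p hp hSp hWp hpp hip
    change dist ((∑ i, signedWeights p.1 p.2 (x p) (y p) i *
      φ (Sum.elim (x p) (y p) i)) / S p) 0 < ε
    rw [hip, Real.dist_eq, sub_zero, abs_div, abs_of_pos hSp, div_lt_iff₀ hSp]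
    refine (abs_integral_sub_le hr0 hpp.2.2 (by positivity) hp hφ).trans_lt ?_
    calc ε / (2 * (C + 1)) * wasserstein r p.1 p.2 ^ r
        ≤ ε / (2 * (C + 1)) * ((C + 1) * S p) :=
          mul_le_mul_of_nonneg_left (by linarith) (by positivity)
      _ = ε / 2 * S p := by field_simp
      _ < ε * S p := mul_lt_mul_of_pos_right (by linarith) hSp
  have hzero_mem : ∀ θ ∈ centers ζ, (0 : Fin q → ℕ) ∈ multiIndices q (cluster ζ θ).card :=
    fun θ hθ => mem_multiIndices.2 (by simpa using card_cluster_pos hθ)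
  have hlim0 : ∑ θ ∈ centers ζ, a θ 0 = 0 := by
    have h1 := tendsto_finsetSum (centers ζ) fun θ hθ => ha θ hθ 0 (hzero_mem θ hθ)
    refine tendsto_nhds_unique h1 (tendsto_const_nhds.congr' ?_)
    filter_upwards [hx, hy] with p hxp hyp
    rw [← Finset.sum_div]
    simp only [clusterMoment, monomial_zero, mul_one]
    rw [sum_centers_cluster, sum_signedWeights hxp hyp, zero_div]
  set e := (centers ζ).equivFin.symm with he
  have hsum : ∀ {M : Type} [AddCommMonoid M] (F : EuclideanSpace ℝ (Fin q) → M),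
      ∑ i, F (e i) = ∑ θ ∈ centers ζ, F θ := fun F => by
    rw [Equiv.sum_comp e fun θ => F θ, Finset.sum_coe_sort]
  -- The multiplicities are the cluster sizes, with sum g + h between 2k₀ and 2k; the factorials of
  -- Taylor's formula go into the coefficients.
  have hind := (hΦ.linearIndependent (centers ζ).card hk₀le (by omega)
    (fun i => (cluster ζ (e i)).card) (fun i => ⟨card_cluster_pos (e i).2, hm _⟩)
    (by rw [hsum fun θ => (cluster ζ θ).card, hsumcard]; omega)
    (by rw [hsum fun θ => (cluster ζ θ).card, hsumcard]; omega)
    (fun i => e i) (fun i j hij => e.injective (Subtype.ext hij))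
    (fun i => by
      obtain ⟨j, hj⟩ := mem_centers.1 (e i).2
      exact hj ▸ hζΘ j)
    (fun i α => a (e i) α / (∏ i, ((α i).factorial : ℝ)))).1
    ⟨fun φ hφ => by
      rw [hsum fun θ => ∑ α ∈ multiIndices q (cluster ζ θ).card,
        a θ α / (∏ i, ((α i).factorial : ℝ)) * partialDeriv α φ θ]
      exact hlimΦ φ hφ, by
      simpa using (hsum fun θ => a θ 0).trans hlim0⟩
    (e.symm ⟨θ₁, hθ₁⟩) α₁ (by simpa using hα₁)
  rw [Equiv.apply_symm_apply] at hind
  exact (div_ne_zero hane (Finset.prod_ne_zero_iff.2 fun i _ => by positivity)) hind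

/-- Lowering m or raising k₀ only shrinks the ranges of ℓ and of the multiplicities. As 2(k - k₀ +
1) - 1 ≤ 2k - 1 for k₀ ≥ 1, the hypothesis of (b) implies that of (a) for every k₀. -/
lemma IsLinearIndependentDomain.mono {Φ : Set (EuclideanSpace ℝ (Fin q) → ℝ)}
    {Θ : Set (EuclideanSpace ℝ (Fin q))} {m m' k₀ k₀' k : ℕ}
    (h : IsLinearIndependentDomain Φ Θ m k₀ k) (hm : m' ≤ m) (hk : k₀ ≤ k₀') :
    IsLinearIndependentDomain Φ Θ m' k₀' k where
  contDiff φ hφ := by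
    obtain ⟨U, hU, hΘU, hφU⟩ := h.contDiff φ hφ
    exact ⟨U, hU, hΘU, hφU.of_le (by exact_mod_cast hm)⟩
  linearIndependent ℓ h1 h2 μ hμ h3 h4 :=
    h.linearIndependent ℓ (hk.trans h1) (by omega) μ
      (fun i => ⟨(hμ i).1, (hμ i).2.trans (by omega)⟩) (by omega) h4

end MixingMeasure

end

theorem theorem3 (q : ℕ) (Θ : Set (EuclideanSpace ℝ (Fin q))) (hΘ : IsCompact Θ)
    (Φ : Set (EuclideanSpace ℝ (Fin q) → ℝ)) (k : ℕ) :
    (∀ k₀ : ℕ, 1 ≤ k₀ → k₀ ≤ k →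
      MixingMeasure.IsLinearIndependentDomain Φ Θ (2 * (k - k₀ + 1) - 1) k₀ k →
      ∀ G₀ ∈ MixingMeasure.exactly k₀ Θ, MixingMeasure.LocalInverseBound Φ Θ k G₀) ∧
    (MixingMeasure.IsLinearIndependentDomain Φ Θ (2 * k - 1) 1 k →
      ∀ G₀ ∈ MixingMeasure.atMost k Θ, MixingMeasure.LocalInverseBound Φ Θ k G₀) := by
  refine ⟨fun k₀ _ hk₀ hΦ G₀ hG₀ =>
    MixingMeasure.localInverseBound_of_isLinearIndependentDomain hΘ hk₀ hΦ hG₀,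
    fun hΦ G₀ hG₀ => ?_⟩
  have hpos : 0 < (MixingMeasure.atoms G₀).card :=
    Finset.card_pos.2 G₀.support_weights_nonempty
  have hle := hG₀.2
  exact MixingMeasure.localInverseBound_of_isLinearIndependentDomain hΘ hG₀.2
    (hΦ.mono (by omega) hpos) ⟨hG₀.1, rfl⟩
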